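/- Let $K$ be a (commutative) field. **Dup-Dend bialgebras.** A Dup-Dend bialgebra over $K$ is a $K$-vector space $A$ with bilinear products $(x,y)\mapsto xy$ and $(x,y)\mapsto x\nwarrow y$ and linear coproducts $\Delta_\prec,\Delta_\succ:A\to A\otimes A$ such that, with $\tilde\Delta=\Delta_\prec+\Delta_\succ$ and the Sweedler notations $\tilde\Delta(a)=a'\otimes a''$, $\Delta_\prec(a)=a'_\prec\otimes a''_\prec$, $\Delta_\succ(a)=a'_\succ\otimes a''_\succ$, for all $x,y,z\in A$: - (duplicial algebra) $(xy)z=x(yz)$, $(x\nwarrow y)\nwarrow z=x\nwarrow(y\nwarrow z)$, $(xy)\nwarrow z=x(y\nwarrow z)$; - (dendriform coalgebra) $(\Delta_\prec\otimes Id)\circ\Delta_\prec=(Id\otimes\tilde\Delta)\circ\Delta_\prec$, $(\Delta_\succ\otimes Id)\circ\Delta_\prec=(Id\otimes\Delta_\prec)\circ\Delta_\succ$, $(\tilde\Delta\otimes Id)\circ\Delta_\succ=(Id\otimes\Delta_\succ)\circ\Delta_\succ$; - (compatibility) $$\Delta_\prec(xy)=y\otimes x+y'_\prec\otimes xy''_\prec+xy'_\prec\otimes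 y''_\prec+x'y\otimes x''+x'y'_\prec\otimes x''y''_\prec,$$ $$\Delta_\succ(xy)=x\otimes y+xy'_\succ\otimes y''_\succ+y'_\succ\otimes xy''_\succ+x'\otimes x''y+x'y'_\succ\otimes x''y''_\succ,$$ $$\Delta_\prec(x\nwarrow y)=x\nwarrow y'_\prec\otimes y''_\prec+x'_\prec\nwarrow y\otimes x''_\prec+x'_\prec\nwarrow y'_\prec\otimes x''_\prec y''_\prec,$$ $$\Delta_\succ(x\nwarrow y)=x\otimes y+x\nwarrow y'_\succ\otimes y''_\succ+x'_\succ\otimes x''_\succ\nwarrow y+x'_\prec\otimes x''_\prec y+x'_\prec\nwarrow y'_\succ\otimes x''_\prec y''_\succ.$$ A morphism of Dup-Dend bialgebras is a linear map between Dup-Dend bialgebras compatible with both products and both coproducts. **The space $\mathbf{FQSym}^+$.** It has as basis all permutations $\sigma\in\mathfrak S_n$, $n\ge 1$, written as words $\sigma(1)\cdots\sigma(n)$. For $\sigma\in\mathfrak S_k$ and $\tau\in\mathfrak S_l$ with $k,l\ge1$, the product $\sigma\tau$ is the sum of all shuffles of the word of $\sigma$ with the word of $\tau$ whose letters have been increased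 by $k$, and $\sigma\nwarrow\tau$ is the sum of those of these shuffles in which all the letters coming from $\tau$ stand after the greatest letter $k$ of $\sigma$. For $\sigma\in\mathfrak S_n$ and $0<k<n$, let $\sigma_1^{(k)}\in\mathfrak S_k$ and $\sigma_2^{(k)}\in\mathfrak S_{n-k}$ be the standardizations of the words $\sigma(1)\cdots\sigma(k)$ and $\sigma(k+1)\cdots\sigma(n)$. Put $$\Delta_\prec(\sigma)=\sum_{k=\sigma^{-1}(n)}^{n-1}\sigma_1^{(k)}\otimes\sigma_2^{(k)},\qquad \Delta_\succ(\sigma)=\sum_{k=1}^{\sigma^{-1}(n)-1}\sigma_1^{(k)}\otimes\sigma_2^{(k)}.$$ **The space $\mathcal H_{SP}^+$.** A special poset is a finite set $P$ with a partial order $\le_1$ and a total order $\le_2$; if $P\neq\emptyset$, $g_P$ denotes its greatest element for $\le_2$. The space $\mathcal H_{SP}^+$ has as basis the isomorphism classes of nonempty special posets. For nonempty special posets $P,Q$, both $PQ$ and $P\nwarrow Q$ have $P\sqcup Q$ as underlying set, contain $P$ and $Q$ with their two orders, and satisfy $x\le_2y$ for all $x\in P$, $y\in Q$; no element of $Q$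 is $\le_1$ an element of $P$; and for $x\in P$, $y\in Q$, never $x\le_1y$ in $PQ$, whereas $x\le_1y$ in $P\nwarrow Q$ if and only if $x\le_1g_P$ in $P$. An ideal of $P$ is a subset $I$ such that $x\in I$ and $x\le_1y$ imply $y\in I$; it is nontrivial if $I\ne\emptyset,P$. Put $$\Delta_\prec(P)=\sum_{I\text{ nontrivial ideal},\ g_P\notin I}(P\setminus I)\otimes I,\qquad \Delta_\succ(P)=\sum_{I\text{ nontrivial ideal},\ g_P\in I}(P\setminus I)\otimes I.$$ **The map $\Theta$.** Let $\Theta:\mathcal H_{SP}^+\to\mathbf{FQSym}^+$ be the linear map sending a special poset $P$ with elements $x_1<_2\cdots<_2x_n$ to the sum of its linear extensions, that is, of all $\sigma\in\mathfrak S_n$ such that $x_i<_1x_j$ implies $\sigma^{-1}(i)<\sigma^{-1}(j)$. **Proposition.** With these products and coproducts, $\mathbf{FQSym}^+$ is a Dup-Dend bialgebra. Moreover $\mathcal H_{SP}^+$ is a Dup-Dend bialgebra and $\Theta:\mathcal H_{SP}^+\to\mathbf{FQSym}^+$ is a morphism of Dup-Dend bialgebras. -/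

import Mathlib

open scoped TensorProduct

noncomputable section

/-! ## Dup-Dend bialgebras -/

/-- A vector space `A` with two products and two coproducts. The axioms are in
`DupDendOps.IsBialgebra`. -/
structure DupDendOps (K A : Type*) [Field K] [AddCommGroup A] [Module K A] where
  /-- the product `x y` -/
  mul : A →ₗ[K] A →ₗ[K] A
  /-- the product `x ↖ y` -/
  nw : A →ₗ[K] A →ₗ[K] A
  /-- the coproduct `Δ_≺` -/
  prec : A →ₗ[K] A ⊗[K] A
  /-- the coproduct `Δ_≻` -/
  succ : A →ₗ[K] A ⊗[K] A

namespace DupDendOps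

variable {K A B : Type*} [Field K] [AddCommGroup A] [Module K A] [AddCommGroup B] [Module K B]

/-- `Δ̃ = Δ_≺ + Δ_≻`. -/
def red (D : DupDendOps K A) : A →ₗ[K] A ⊗[K] A := D.prec + D.succ

/-- The axioms of a duplicial algebra. -/
structure IsDuplicial (D : DupDendOps K A) : Prop where
  mul_assoc : ∀ x y z, D.mul (D.mul x y) z = D.mul x (D.mul y z)
  nw_assoc : ∀ x y z, D.nw (D.nw x y) z = D.nw x (D.nw y z)
  mul_nw : ∀ x y z, D.nw (D.mul x y) z = D.mul x (D.nw y z)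

/-- The axioms of a dendriform coalgebra (`(A ⊗ A) ⊗ A` and `A ⊗ (A ⊗ A)` are identified
by the associator). -/
structure IsDendriform (D : DupDendOps K A) : Prop where
  prec_prec : ∀ x, TensorProduct.assoc K A A A (D.prec.rTensor A (D.prec x)) =
    D.red.lTensor A (D.prec x)
  succ_prec : ∀ x, TensorProduct.assoc K A A A (D.succ.rTensor A (D.prec x)) =
    D.prec.lTensor A (D.succ x)
  red_succ : ∀ x, TensorProduct.assoc K A A A (D.red.rTensor A (D.succ x)) =
    D.succ.lTensor A (D.succ x)

/-- The axioms of a Dup-Dend bialgebra. Sweedler notation is rendered as follows: for a tensor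
`t = t' ⊗ t''`, `f.rTensor A t = f t' ⊗ t''`, `f.lTensor A t = t' ⊗ f t''`, and
`TensorProduct.map₂ f g t u = f t' u' ⊗ g t'' u''`; `D.mul.flip y` is `x ↦ x y`. -/
structure IsBialgebra (D : DupDendOps K A) : Prop where
  duplicial : D.IsDuplicial
  dendriform : D.IsDendriform
  /-- `Δ_≺(xy) = y ⊗ x + y'_≺ ⊗ x y''_≺ + x y'_≺ ⊗ y''_≺ + x'y ⊗ x'' + x' y'_≺ ⊗ x'' y''_≺` -/
  prec_mul : ∀ x y, D.prec (D.mul x y) =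
    y ⊗ₜ[K] x + (D.mul x).lTensor A (D.prec y) + (D.mul x).rTensor A (D.prec y)
      + (D.mul.flip y).rTensor A (D.red x)
      + TensorProduct.map₂ D.mul D.mul (D.red x) (D.prec y)
  /-- `Δ_≻(xy) = x ⊗ y + x y'_≻ ⊗ y''_≻ + y'_≻ ⊗ x y''_≻ + x' ⊗ x'' y + x' y'_≻ ⊗ x'' y''_≻` -/
  succ_mul : ∀ x y, D.succ (D.mul x y) =
    x ⊗ₜ[K] y + (D.mul x).rTensor A (D.succ y) + (D.mul x).lTensor A (D.succ y)
      + (D.mul.flip y).lTensor A (D.red x)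
      + TensorProduct.map₂ D.mul D.mul (D.red x) (D.succ y)
  /-- `Δ_≺(x ↖ y) = x ↖ y'_≺ ⊗ y''_≺ + x'_≺ ↖ y ⊗ x''_≺ + x'_≺ ↖ y'_≺ ⊗ x''_≺ y''_≺` -/
  prec_nw : ∀ x y, D.prec (D.nw x y) =
    (D.nw x).rTensor A (D.prec y) + (D.nw.flip y).rTensor A (D.prec x)
      + TensorProduct.map₂ D.nw D.mul (D.prec x) (D.prec y)
  /-- `Δ_≻(x ↖ y) = x ⊗ y + x ↖ y'_≻ ⊗ y''_≻ + x'_≻ ⊗ x''_≻ ↖ y + x'_≺ ⊗ x''_≺ y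
  + x'_≺ ↖ y'_≻ ⊗ x''_≺ y''_≻` -/
  succ_nw : ∀ x y, D.succ (D.nw x y) =
    x ⊗ₜ[K] y + (D.nw x).rTensor A (D.succ y) + (D.nw.flip y).lTensor A (D.succ x)
      + (D.mul.flip y).lTensor A (D.prec x)
      + TensorProduct.map₂ D.nw D.mul (D.prec x) (D.succ y)

/-- A linear map compatible with both products and both coproducts. -/
structure IsMorphism (D : DupDendOps K A) (E : DupDendOps K B) (f : A →ₗ[K] B) : Prop where
  map_mul : ∀ x y, f (D.mul x y) = E.mul (f x) (f y)
  map_nw : ∀ x y, f (D.nw x y) = E.nw (f x) (f y)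
  map_prec : ∀ x, TensorProduct.map f f (D.prec x) = E.prec (f x)
  map_succ : ∀ x, TensorProduct.map f f (D.succ x) = E.succ (f x)

end DupDendOps

/-! ## Special posets -/

/-- A nonempty special poset up to isomorphism. As the second order `≤₂` is total, its underlying
set is identified with `Fin n` (with `n > 0`), `≤₂` being the usual order; the datum that remains
is the partial order `≤₁`, here `le`. -/
@[ext]
structure SpecialPoset where
  n : ℕ
  pos : 0 < n
  le : Fin n → Fin n → Prop
  refl : ∀ x, le x x
  antisymm : ∀ x y, le x y → le y x → x = y
  trans : ∀ x y z, le x y → le y z → le x z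

namespace SpecialPoset

/-- The isomorphism class of the special poset `(α, r, ≤)`, where `≤` is the given total order
on `α`: transport of `r` along the unique increasing bijection `Fin (card α) ≃ α`. -/
def ofRel {α : Type*} [Fintype α] [LinearOrder α] [Nonempty α] (r : α → α → Prop)
    (hr : ∀ x, r x x) (ha : ∀ x y, r x y → r y x → x = y)
    (ht : ∀ x y z, r x y → r y z → r x z) : SpecialPoset where
  n := Fintype.card α
  pos := Fintype.card_pos
  le i j := r (Fintype.orderIsoFinOfCardEq α rfl i) (Fintype.orderIsoFinOfCardEq α rfl j)
  refl _ := hr _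
  antisymm _ _ h h' := (Fintype.orderIsoFinOfCardEq α rfl).injective (ha _ _ h h')
  trans _ _ _ h h' := ht _ _ _ h h'

/-- `g_P`, the maximal element for `≤₂`. -/
def top (P : SpecialPoset) : Fin P.n := ⟨P.n - 1, Nat.sub_lt P.pos Nat.one_pos⟩

/-- The double subposet of `P` on a nonempty subset `s`. -/
def restrict (P : SpecialPoset) (s : Finset (Fin P.n)) (hs : s.Nonempty) : SpecialPoset :=
  haveI : Nonempty {x // x ∈ s} := hs.to_subtype
  ofRel (α := {x // x ∈ s}) (fun x y => P.le x y)
    (fun _ => P.refl _) (fun _ _ h h' => Subtype.ext (P.antisymm _ _ h h'))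
    (fun _ _ _ h h' => P.trans _ _ _ h h')

/-- The order `≤₁` of the composition `PQ`: no relation between `P` and `Q`. -/
def mulRel (P Q : SpecialPoset) : Fin P.n ⊕ Fin Q.n → Fin P.n ⊕ Fin Q.n → Prop
  | .inl x, .inl y => P.le x y
  | .inr x, .inr y => Q.le x y
  | .inl _, .inr _ => False
  | .inr _, .inl _ => False

/-- The order `≤₁` of `P ↖ Q`: for `x ∈ P`, `y ∈ Q`, `x ≤₁ y` iff `x ≤₁ g_P`. -/
def nwRel (P Q : SpecialPoset) : Fin P.n ⊕ Fin Q.n → Fin P.n ⊕ Fin Q.n → Prop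
  | .inl x, .inl y => P.le x y
  | .inr x, .inr y => Q.le x y
  | .inl x, .inr _ => P.le x P.top
  | .inr _, .inl _ => False

instance instNonemptyLex (P Q : SpecialPoset) : Nonempty (Fin P.n ⊕ₗ Fin Q.n) :=
  ⟨toLex (Sum.inl P.top)⟩

/-- The composition `PQ`, on the disjoint union of `P` and `Q`; for `≤₂`, every element of `P` is
smaller than every element of `Q` (lexicographic sum of total orders). -/
def mul (P Q : SpecialPoset) : SpecialPoset :=
  ofRel (α := Fin P.n ⊕ₗ Fin Q.n) (fun x y => mulRel P Q (ofLex x) (ofLex y))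
    (by rintro (x | x)
        · exact P.refl x
        · exact Q.refl x)
    (by rintro (x | x) (y | y) h h'
        · exact congrArg Sum.inlₗ (P.antisymm x y h h')
        · exact h.elim
        · exact h.elim
        · exact congrArg Sum.inrₗ (Q.antisymm x y h h'))
    (by rintro (x | x) (y | y) (z | z) h h'
        all_goals first
          | exact P.trans x y z h h'
          | exact Q.trans x y z h h'
          | exact h.elim
          | exact h'.elim)

/-- The special poset `P ↖ Q`, on the same totally ordered set as `PQ`. -/
def nw (P Q : SpecialPoset) : SpecialPoset :=
  ofRel (α := Fin P.n ⊕ₗ Fin Q.n) (fun x y => nwRel P Q (ofLex x) (ofLex y))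
    (by rintro (x | x)
        · exact P.refl x
        · exact Q.refl x)
    (by rintro (x | x) (y | y) h h'
        · exact congrArg Sum.inlₗ (P.antisymm x y h h')
        · exact h'.elim
        · exact h.elim
        · exact congrArg Sum.inrₗ (Q.antisymm x y h h'))
    (by rintro (x | x) (y | y) (z | z) h h'
        · exact P.trans x y z h h'
        · exact P.trans x y P.top h h'
        · exact h'.elim
        · exact h
        · exact h.elim
        · exact h.elim
        · exact h'.elim
        · exact Q.trans x y z h h')

/-- `I` is a (1-)ideal of `P` different from `∅` and from `P`. -/
def IsNontrivialIdeal (P : SpecialPoset) (I : Finset (Fin P.n)) : Prop :=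
  (∀ x ∈ I, ∀ y, P.le x y → y ∈ I) ∧ I.Nonempty ∧ Iᶜ.Nonempty

/-- `σ` is a linear extension of `P`: it lists the elements of `P` (as the word
`σ(1) ... σ(n)`) in an order compatible with `≤₁`. -/
def IsLinearExtension (P : SpecialPoset) (σ : Equiv.Perm (Fin P.n)) : Prop :=
  ∀ i j, P.le i j → i ≠ j → σ.symm i < σ.symm j

end SpecialPoset

/-- The space `h_SP⁺`, with basis the isoclasses of nonempty special posets. -/
abbrev HSPPlus (K : Type*) [Field K] : Type _ := SpecialPoset →₀ K

open Classical in
/-- The two products and the two coproducts of `h_SP⁺`: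
`Δ_≺(P)` (resp. `Δ_≻(P)`) is the sum of `(P \ I) ⊗ I` over the nontrivial ideals `I` of `P` that
do not contain (resp. contain) `g_P`. -/
def HSPPlus.ops (K : Type*) [Field K] : DupDendOps K (HSPPlus K) where
  mul := Finsupp.linearCombination K fun P => Finsupp.linearCombination K fun Q =>
    Finsupp.single (P.mul Q) (1 : K)
  nw := Finsupp.linearCombination K fun P => Finsupp.linearCombination K fun Q =>
    Finsupp.single (P.nw Q) (1 : K)
  prec := Finsupp.linearCombination K fun P =>
    ∑ I : {I : Finset (Fin P.n) // P.IsNontrivialIdeal I ∧ P.top ∉ I},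
      Finsupp.single (P.restrict I.1ᶜ I.2.1.2.2) (1 : K) ⊗ₜ[K]
        Finsupp.single (P.restrict I.1 I.2.1.2.1) (1 : K)
  succ := Finsupp.linearCombination K fun P =>
    ∑ I : {I : Finset (Fin P.n) // P.IsNontrivialIdeal I ∧ P.top ∈ I},
      Finsupp.single (P.restrict I.1ᶜ I.2.1.2.2) (1 : K) ⊗ₜ[K]
        Finsupp.single (P.restrict I.1 I.2.1.2.1) (1 : K)

/-! ## Free quasi-symmetric functions -/

/-- A permutation `σ ∈ 𝔖_n` with `n ≥ 1`, seen as the word `σ(1) ... σ(n)`; positions and letters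
are indexed by `Fin n`, that is, from `0`. -/
structure PermWord where
  n : ℕ
  pos : 0 < n
  perm : Equiv.Perm (Fin n)

namespace PermWord

/-- Standardization: a word without repetition, given as a bijection `e` from its totally ordered
set of positions to its totally ordered set of letters, becomes a permutation by the unique
increasing renumberings of positions and letters. -/
def std {α β : Type*} [Fintype α] [LinearOrder α] [Nonempty α] [Fintype β] [LinearOrder β]
    (e : α ≃ β) : PermWord where
  n := Fintype.card α
  pos := Fintype.card_pos
  perm := (Fintype.orderIsoFinOfCardEq α rfl).toEquiv.trans
    (e.trans (Fintype.orderIsoFinOfCardEq β (Fintype.card_congr e).symm).symm.toEquiv)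

/-- The standardization of the subword of `σ` at the positions in `s`. -/
def subword (σ : PermWord) (s : Finset (Fin σ.n)) (hs : s.Nonempty) : PermWord :=
  haveI : Nonempty {i // i ∈ s} := hs.to_subtype
  std (α := {i // i ∈ s}) (β := {x // σ.perm.symm x ∈ s})
    (σ.perm.subtypeEquiv fun i => by simp)

/-- `σ₁^(k)`: the first `k` letters of `σ`, standardized. -/
def left (σ : PermWord) (k : Fin σ.n) (hk : 0 < k.val) : PermWord :=
  σ.subword (Finset.Iio k) ⟨⟨0, σ.pos⟩, Finset.mem_Iio.2 hk⟩

/-- `σ₂^(k)`: the last `n - k` letters of `σ`, standardized. -/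
def right (σ : PermWord) (k : Fin σ.n) : PermWord :=
  σ.subword (Finset.Ici k) ⟨k, Finset.mem_Ici.2 le_rfl⟩

/-- The position `σ⁻¹(n)` of the greatest letter of `σ`, counted from `0`. -/
def posMax (σ : PermWord) : Fin σ.n := σ.perm.symm ⟨σ.n - 1, Nat.sub_lt σ.pos Nat.one_pos⟩

/-- `ε ∈ Sh(k, l)`: `ε⁻¹` is increasing on the first `k` and on the last `l` elements. -/
def IsShuffle (k l : ℕ) (ε : Equiv.Perm (Fin (k + l))) : Prop :=
  StrictMono (fun i : Fin k => ε.symm (Fin.castAdd l i)) ∧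
    StrictMono (fun j : Fin l => ε.symm (Fin.natAdd k j))

/-- `(σ ⊗ τ) ∘ ε`, where the word of `σ ⊗ τ` is that of `σ` followed by that of `τ` shifted by
the degree of `σ`. -/
def shuffled (σ τ : PermWord) (ε : Equiv.Perm (Fin (σ.n + τ.n))) : PermWord where
  n := σ.n + τ.n
  pos := Nat.add_pos_left σ.pos _
  perm := ε.trans (finSumFinEquiv.permCongr (Equiv.sumCongr σ.perm τ.perm))

end PermWord

/-- The space `FQSym⁺`, with basis all permutations of degree at least `1`. -/
abbrev FQSymPlus (K : Type*) [Field K] : Type _ := PermWord →₀ K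

open Classical in
/-- The two products and the two coproducts of `FQSym⁺`. The product `σ τ` is the sum of all
shuffles of the word of `σ` with the shifted word of `τ`; `σ ↖ τ` is the sum of those in which
the letters of `τ` (equivalently, the first one) are after the greatest letter of `σ`. The
coproduct `Δ_≺(σ)` (resp. `Δ_≻(σ)`) is the sum of `σ₁^(k) ⊗ σ₂^(k)` over the cuts `0 < k < n` for
which the greatest letter is in the left (resp. right) part. -/
def FQSymPlus.ops (K : Type*) [Field K] : DupDendOps K (FQSymPlus K) where
  mul := Finsupp.linearCombination K fun σ => Finsupp.linearCombination K fun τ =>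
    ∑ ε : Equiv.Perm (Fin (σ.n + τ.n)) with PermWord.IsShuffle σ.n τ.n ε,
      Finsupp.single (σ.shuffled τ ε) (1 : K)
  nw := Finsupp.linearCombination K fun σ => Finsupp.linearCombination K fun τ =>
    ∑ ε : Equiv.Perm (Fin (σ.n + τ.n)) with PermWord.IsShuffle σ.n τ.n ε ∧
        ε.symm (Fin.castAdd τ.n σ.posMax) ≤ ε.symm (Fin.natAdd σ.n ⟨0, τ.pos⟩),
      Finsupp.single (σ.shuffled τ ε) (1 : K)
  prec := Finsupp.linearCombination K fun σ =>
    ∑ k : {k : Fin σ.n // σ.posMax < k},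
      Finsupp.single (σ.left k.1 ((Nat.zero_le _).trans_lt k.2)) (1 : K) ⊗ₜ[K]
        Finsupp.single (σ.right k.1) (1 : K)
  succ := Finsupp.linearCombination K fun σ =>
    ∑ k : {k : Fin σ.n // 0 < k.val ∧ k ≤ σ.posMax},
      Finsupp.single (σ.left k.1 k.2.1) (1 : K) ⊗ₜ[K]
        Finsupp.single (σ.right k.1) (1 : K)

open Classical in
/-- `Θ : h_SP⁺ → FQSym⁺` sends `P` to the sum of its linear extensions. -/
def thetaPlus (K : Type*) [Field K] : HSPPlus K →ₗ[K] FQSymPlus K :=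
  Finsupp.linearCombination K fun P =>
    ∑ σ : Equiv.Perm (Fin P.n) with P.IsLinearExtension σ,
      Finsupp.single (PermWord.mk P.n P.pos σ) (1 : K)

end

/-! No axiom is checked on permutations. The positions of the letters of `σ` define a total order
`≤₁`, and the special poset `σ.toPoset` so obtained has `σ` as its only linear extension, so `Θ` is
surjective. Once `Θ` respects the four operations, the axioms pass from special posets to
permutations (`isBialgebra_of_surjective`).

For special posets, everything is computed inside one ambient totally ordered set carrying a
relation `q`: `cls K q S` is the class of a finite subset `S`, and it vanishes for `S = ∅`.
Subposets become subsets, both products become unions, and trivial ideals contribute nothing to the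
coproducts. The dendriform axioms count partitions into three blocks by two nested ideals
(`sum_ideals_sdiff`); the block containing the greatest element selects the axiom. The
compatibilities come from the ideals of `PQ` and `P ↖ Q`. In `PQ` they are the unions of an ideal of
`P` and one of `Q` (`sum_ideals_union_of_mul`). In `P ↖ Q` an ideal containing `g_P` contains `Q`,
and the others are again arbitrary unions (`sum_ideals_union_of_nw`). Separating the trivial ideals
of each factor yields the terms of the axioms one by one.

For `Θ` and the products, a permutation of `k + l` letters is uniquely a shuffle of a permutation of
the small letters and one of the large letters (`sum_perm_eq_sum_shuffle`). For the coproducts,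
cutting a linear extension of `P` amounts to choosing an ideal `I` and linear extensions of `P \ I`
and `I`; the inverse operation is the ordinal sum (`sum_cut_linearOrdersOn`). -/

namespace SpecialPoset

theorem eq_of_cast {P Q : SpecialPoset} (h : P.n = Q.n)
    (hle : ∀ i j, P.le i j ↔ Q.le (Fin.cast h i) (Fin.cast h j)) : P = Q := by
  cases P
  cases Q
  dsimp only at h
  subst h
  congr
  funext i j
  exact propext (hle i j)

/-- The increasing bijection from `Fin n` to a finite total order is unique, so any `e` can replace
the enumeration built into `ofRel`. -/
theorem ofRel_eq {α : Type*} [Fintype α] [LinearOrder α] [Nonempty α] {r : α → α → Prop}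
    (hr : ∀ x, r x x) (ha : ∀ x y, r x y → r y x → x = y) (ht : ∀ x y z, r x y → r y z → r x z)
    {P : SpecialPoset} (e : Fin P.n ≃o α) (h : ∀ i j, P.le i j ↔ r (e i) (e j)) :
    ofRel r hr ha ht = P := by
  have hn : Fintype.card α = P.n := by
    rw [← Fintype.card_congr e.toEquiv, Fintype.card_fin]
  refine eq_of_cast hn fun i j => ?_
  have he : Fintype.orderIsoFinOfCardEq α rfl = (Fin.castOrderIso hn).trans e :=
    Subsingleton.elim _ _
  rw [h]
  change r (Fintype.orderIsoFinOfCardEq α rfl i) (Fintype.orderIsoFinOfCardEq α rfl j) ↔ _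
  rw [he]
  rfl

theorem le_top (P : SpecialPoset) (i : Fin P.n) : i ≤ P.top :=
  Nat.le_sub_one_of_lt i.2

end SpecialPoset

/-! ### Special posets carried by finite subsets of a total order -/

/-- The relation `q` is a partial order on the finite set `S`. -/
structure IsOrderOn {γ : Type*} (q : γ → γ → Prop) (S : Finset γ) : Prop where
  refl : ∀ x ∈ S, q x x
  antisymm : ∀ x ∈ S, ∀ y ∈ S, q x y → q y x → x = y
  trans : ∀ x ∈ S, ∀ y ∈ S, ∀ z ∈ S, q x y → q y z → q x z

theorem IsOrderOn.mono {γ : Type*} {q : γ → γ → Prop} {S T : Finset γ} (h : IsOrderOn q T)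
    (hST : S ⊆ T) : IsOrderOn q S where
  refl x hx := h.refl x (hST hx)
  antisymm x hx y hy := h.antisymm x (hST hx) y (hST hy)
  trans x hx y hy z hz := h.trans x (hST hx) y (hST hy) z (hST hz)

theorem SpecialPoset.isOrderOn (P : SpecialPoset) (S : Finset (Fin P.n)) :
    IsOrderOn P.le S where
  refl x _ := P.refl x
  antisymm x _ y _ := P.antisymm x y
  trans x _ y _ z _ := P.trans x y z

namespace HSPPlus

variable {γ δ : Type*} [LinearOrder γ] [LinearOrder δ]

/-- The special poset carried by a nonempty finite subset of a totally ordered set. -/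
def posetOn (q : γ → γ → Prop) (S : Finset γ) (hS : S.Nonempty) (hq : IsOrderOn q S) :
    SpecialPoset :=
  have : Nonempty {x // x ∈ S} := hS.to_subtype
  SpecialPoset.ofRel (α := {x // x ∈ S}) (fun x y => q x y)
    (fun x => hq.refl x x.2) (fun x y h h' => Subtype.ext (hq.antisymm x x.2 y y.2 h h'))
    (fun x y z h h' => hq.trans x x.2 y y.2 z z.2 h h')

open Classical in
/-- The basis element of `HSPPlus K` given by a finite subset `S` of a totally ordered set and a
partial order `q` on `S`; it is zero if `S` is empty. -/
noncomputable def cls (K : Type*) [Field K] (q : γ → γ → Prop) (S : Finset γ) : HSPPlus K :=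
  if h : S.Nonempty ∧ IsOrderOn q S then Finsupp.single (posetOn q S h.1 h.2) 1 else 0

/-- `P` is isomorphic to the special poset `(S, q)` by means of `f`. -/
structure Represents (P : SpecialPoset) (q : γ → γ → Prop) (S : Finset γ) (f : Fin P.n → γ) :
    Prop where
  strictMono : StrictMono f
  image_eq : Finset.univ.image f = S
  le_iff : ∀ i j, P.le i j ↔ q (f i) (f j)

variable {K : Type*} [Field K]

@[simp]
theorem cls_empty (q : γ → γ → Prop) : cls K q ∅ = 0 := by
  simp [cls]

namespace Represents

variable {P : SpecialPoset} {q : γ → γ → Prop} {S : Finset γ} {f : Fin P.n → γ}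

theorem mem (h : Represents P q S f) (i : Fin P.n) : f i ∈ S := by
  rw [← h.image_eq]
  exact Finset.mem_image_of_mem f (Finset.mem_univ i)

theorem exists_eq (h : Represents P q S f) {x : γ} (hx : x ∈ S) : ∃ i, f i = x := by
  rw [← h.image_eq] at hx
  simpa using hx

theorem nonempty (h : Represents P q S f) : S.Nonempty := ⟨_, h.mem P.top⟩

theorem isOrderOn (h : Represents P q S f) : IsOrderOn q S where
  refl x hx := by
    obtain ⟨i, rfl⟩ := h.exists_eq hx
    exact (h.le_iff i i).1 (P.refl i)
  antisymm x hx y hy := by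
    obtain ⟨i, rfl⟩ := h.exists_eq hx
    obtain ⟨j, rfl⟩ := h.exists_eq hy
    rw [← h.le_iff, ← h.le_iff]
    exact fun h₁ h₂ => congrArg f (P.antisymm i j h₁ h₂)
  trans x hx y hy z hz := by
    obtain ⟨i, rfl⟩ := h.exists_eq hx
    obtain ⟨j, rfl⟩ := h.exists_eq hy
    obtain ⟨k, rfl⟩ := h.exists_eq hz
    rw [← h.le_iff, ← h.le_iff, ← h.le_iff]
    exact P.trans i j k

/-- Corestricted to `S`, the map `f` is an increasing bijection matching `≤₁` with `q`, and
`ofRel_eq` applies. This is the passage between basis elements and subsets of an ambient order. -/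
theorem cls_eq (h : Represents P q S f) : cls K q S = Finsupp.single P 1 := by
  rw [cls, dif_pos ⟨h.nonempty, h.isOrderOn⟩]
  congr 1
  have : Nonempty {x // x ∈ S} := h.nonempty.to_subtype
  have hb : Function.Surjective (fun i => (⟨f i, h.mem i⟩ : {x // x ∈ S})) := by
    rintro ⟨x, hx⟩
    obtain ⟨i, rfl⟩ := h.exists_eq hx
    exact ⟨i, rfl⟩
  exact SpecialPoset.ofRel_eq (r := fun x y : {x // x ∈ S} => q x y)
    (fun x => h.isOrderOn.refl x x.2)
    (fun x y h₁ h₂ => Subtype.ext (h.isOrderOn.antisymm x x.2 y y.2 h₁ h₂))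
    (fun x y z h₁ h₂ => h.isOrderOn.trans x x.2 y y.2 z z.2 h₁ h₂)
    (StrictMono.orderIsoOfSurjective (fun i => (⟨f i, h.mem i⟩ : {x // x ∈ S}))
      (fun i j hij => h.strictMono hij) hb) h.le_iff

theorem isGreatest (h : Represents P q S f) : IsGreatest (S : Set γ) (f P.top) := by
  refine ⟨h.mem _, fun x hx => ?_⟩
  obtain ⟨i, rfl⟩ := h.exists_eq hx
  exact h.strictMono.monotone (P.le_top i)

theorem comp (h : Represents P q S f) {r : δ → δ → Prop} {g : γ → δ}
    (hg : ∀ x ∈ S, ∀ y ∈ S, x < y → g x < g y)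
    (hr : ∀ x ∈ S, ∀ y ∈ S, q x y ↔ r (g x) (g y)) :
    Represents P r (S.image g) (g ∘ f) where
  strictMono i j hij := hg _ (h.mem i) _ (h.mem j) (h.strictMono hij)
  image_eq := by rw [← h.image_eq, Finset.image_image]
  le_iff i j := (h.le_iff i j).trans (hr _ (h.mem i) _ (h.mem j))

end Represents

theorem represents_self (P : SpecialPoset) : Represents P P.le Finset.univ id where
  strictMono := strictMono_id
  image_eq := Finset.image_id
  le_iff _ _ := Iff.rfl

theorem exists_represents {q : γ → γ → Prop} {S : Finset γ} (hS : S.Nonempty)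
    (hq : IsOrderOn q S) : ∃ P f, Represents P q S f := by
  have : Nonempty {x // x ∈ S} := hS.to_subtype
  let e := Fintype.orderIsoFinOfCardEq {x // x ∈ S} rfl
  refine ⟨posetOn q S hS hq, fun i => (e i : γ), fun i j hij => e.strictMono hij, ?_,
    fun i j => Iff.rfl⟩
  ext x
  simp only [Finset.mem_image, Finset.mem_univ, true_and]
  constructor
  · rintro ⟨i, rfl⟩
    exact (e i).2
  · intro hx
    exact ⟨e.symm ⟨x, hx⟩, by simp⟩

/-- Invariance under isomorphism: a special poset representing `S` through `f` represents the image
through `g ∘ f`. -/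
theorem cls_congr {q : γ → γ → Prop} {r : δ → δ → Prop} {S : Finset γ} (hq : IsOrderOn q S)
    (g : γ → δ) (hg : ∀ x ∈ S, ∀ y ∈ S, x < y → g x < g y)
    (hr : ∀ x ∈ S, ∀ y ∈ S, q x y ↔ r (g x) (g y)) : cls K r (S.image g) = cls K q S := by
  obtain rfl | hS := S.eq_empty_or_nonempty
  · simp
  · obtain ⟨P, f, h⟩ := exists_represents hS hq
    rw [h.cls_eq, (h.comp hg hr).cls_eq]

theorem cls_congr_rel {q r : γ → γ → Prop} {S : Finset γ} (hq : IsOrderOn q S)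
    (h : ∀ x ∈ S, ∀ y ∈ S, q x y ↔ r x y) : cls K r S = cls K q S := by
  simpa using cls_congr (K := K) hq id (fun _ _ _ _ h => h) h

theorem cls_univ (P : SpecialPoset) : cls K P.le Finset.univ = Finsupp.single P 1 :=
  (represents_self P).cls_eq

theorem cls_restrict (P : SpecialPoset) (S : Finset (Fin P.n)) (hS : S.Nonempty) :
    Finsupp.single (P.restrict S hS) 1 = cls K P.le S := by
  rw [cls, dif_pos ⟨hS, P.isOrderOn S⟩]
  rfl

/-! ### Products -/

@[simp]
theorem mul_single (P Q : SpecialPoset) :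
    (ops K).mul (Finsupp.single P 1) (Finsupp.single Q 1) = Finsupp.single (P.mul Q) 1 := by
  simp [ops]

@[simp]
theorem nw_single (P Q : SpecialPoset) :
    (ops K).nw (Finsupp.single P 1) (Finsupp.single Q 1) = Finsupp.single (P.nw Q) 1 := by
  simp [ops]

section products

variable {P Q : SpecialPoset} {q : γ → γ → Prop} {S T : Finset γ} {f : Fin P.n → γ}
  {g : Fin Q.n → γ}

/-- Serves both products: they share the lexicographic sum as underlying order, and only `h` depends
on how `P` and `Q` are related by `≤₁`. -/
theorem represents_ofRel_sum (hf : Represents P q S f) (hg : Represents Q q T g)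
    (hST : ∀ x ∈ S, ∀ y ∈ T, x < y)
    {r : Fin P.n ⊕ₗ Fin Q.n → Fin P.n ⊕ₗ Fin Q.n → Prop} (hr ha ht)
    (h : ∀ x y, r x y ↔ q (Sum.elim f g (ofLex x)) (Sum.elim f g (ofLex y))) :
    Represents (SpecialPoset.ofRel r hr ha ht) q (S ∪ T)
      (fun i => Sum.elim f g (ofLex (Fintype.orderIsoFinOfCardEq (Fin P.n ⊕ₗ Fin Q.n) rfl i)))
    where
  strictMono := by
    have hm : StrictMono fun x : Fin P.n ⊕ₗ Fin Q.n => Sum.elim f g (ofLex x) := by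
      rintro (x | x) (y | y) hxy
      · exact hf.strictMono (Sum.Lex.inl_lt_inl_iff.1 hxy)
      · exact hST _ (hf.mem x) _ (hg.mem y)
      · exact (Sum.Lex.not_inr_lt_inl hxy).elim
      · exact hg.strictMono (Sum.Lex.inr_lt_inr_iff.1 hxy)
    exact hm.comp (OrderIso.strictMono _)
  image_eq := by
    rw [← hf.image_eq, ← hg.image_eq]
    ext z
    simp only [Finset.mem_image, Finset.mem_union, Finset.mem_univ, true_and]
    constructor
    · rintro ⟨i, rfl⟩
      rcases h : ofLex (Fintype.orderIsoFinOfCardEq (Fin P.n ⊕ₗ Fin Q.n) rfl i) with x | x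
      · exact Or.inl ⟨x, rfl⟩
      · exact Or.inr ⟨x, rfl⟩
    · rintro (⟨i, rfl⟩ | ⟨i, rfl⟩)
      · exact ⟨(Fintype.orderIsoFinOfCardEq (Fin P.n ⊕ₗ Fin Q.n) rfl).symm
          (toLex (Sum.inl i)), by rw [OrderIso.apply_symm_apply]; rfl⟩
      · exact ⟨(Fintype.orderIsoFinOfCardEq (Fin P.n ⊕ₗ Fin Q.n) rfl).symm
          (toLex (Sum.inr i)), by rw [OrderIso.apply_symm_apply]; rfl⟩
  le_iff i j := h _ _

theorem mul_cls (hS : S.Nonempty) (hT : T.Nonempty) (hqS : IsOrderOn q S) (hqT : IsOrderOn q T)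
    (hST : ∀ x ∈ S, ∀ y ∈ T, x < y)
    (h₁ : ∀ x ∈ S, ∀ y ∈ T, ¬ q x y) (h₂ : ∀ x ∈ S, ∀ y ∈ T, ¬ q y x) :
    (ops K).mul (cls K q S) (cls K q T) = cls K q (S ∪ T) := by
  obtain ⟨P, f, hf⟩ := exists_represents hS hqS
  obtain ⟨Q, g, hg⟩ := exists_represents hT hqT
  rw [hf.cls_eq, hg.cls_eq, mul_single]
  refine (represents_ofRel_sum hf hg hST _ _ _ ?_).cls_eq.symm
  rintro (x | x) (y | y)
  · exact hf.le_iff x y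
  · exact iff_of_false id (h₁ _ (hf.mem x) _ (hg.mem y))
  · exact iff_of_false id (h₂ _ (hf.mem y) _ (hg.mem x))
  · exact hg.le_iff x y

theorem nw_cls (hT : T.Nonempty) (hqS : IsOrderOn q S) (hqT : IsOrderOn q T)
    (hST : ∀ x ∈ S, ∀ y ∈ T, x < y) {m : γ} (hm : IsGreatest (S : Set γ) m)
    (h₁ : ∀ x ∈ S, ∀ y ∈ T, (q x y ↔ q x m)) (h₂ : ∀ x ∈ S, ∀ y ∈ T, ¬ q y x) :
    (ops K).nw (cls K q S) (cls K q T) = cls K q (S ∪ T) := by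
  obtain ⟨P, f, hf⟩ := exists_represents ⟨m, hm.1⟩ hqS
  obtain ⟨Q, g, hg⟩ := exists_represents hT hqT
  rw [hf.cls_eq, hg.cls_eq, nw_single]
  refine (represents_ofRel_sum hf hg hST _ _ _ ?_).cls_eq.symm
  rintro (x | x) (y | y)
  · exact hf.le_iff x y
  · refine Iff.trans ?_ (h₁ _ (hf.mem x) _ (hg.mem y)).symm
    rw [hm.unique hf.isGreatest]
    exact hf.le_iff x P.top
  · exact iff_of_false id (h₂ _ (hf.mem y) _ (hg.mem x))
  · exact hg.le_iff x y

end products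

/-! ### Coproducts -/

open Classical in
/-- The ideals (up-sets) of `S` for the relation `q`. -/
noncomputable def ideals (q : γ → γ → Prop) (S : Finset γ) : Finset (Finset γ) :=
  S.powerset.filter fun I => ∀ x ∈ I, ∀ y ∈ S, q x y → y ∈ I

theorem mem_ideals {q : γ → γ → Prop} {S I : Finset γ} :
    I ∈ ideals q S ↔ I ⊆ S ∧ ∀ x ∈ I, ∀ y ∈ S, q x y → y ∈ I := by
  simp [ideals]

theorem empty_mem_ideals (q : γ → γ → Prop) (S : Finset γ) : ∅ ∈ ideals q S := by
  simp [mem_ideals]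

theorem self_mem_ideals (q : γ → γ → Prop) (S : Finset γ) : S ∈ ideals q S := by
  simp +contextual [mem_ideals]

/-- The ideals `∅` and `P` may be added freely, since one tensor factor is then `cls` of the empty
set, which is zero. -/
theorem sum_nontrivialIdeal (P : SpecialPoset) (p : Finset (Fin P.n) → Prop) [DecidablePred p]
    [Fintype {I : Finset (Fin P.n) // P.IsNontrivialIdeal I ∧ p I}] :
    ∑ I : {I : Finset (Fin P.n) // P.IsNontrivialIdeal I ∧ p I},
      cls K P.le I.1ᶜ ⊗ₜ[K] cls K P.le I.1 =
    ∑ I ∈ ideals P.le Finset.univ with p I,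
      cls K P.le (Finset.univ \ I) ⊗ₜ[K] cls K P.le I := by
  classical
  rw [← Finset.sum_subtype (Finset.univ.filter fun I => P.IsNontrivialIdeal I ∧ p I)
    (fun I => by simp) (fun I => cls K P.le Iᶜ ⊗ₜ[K] cls K P.le I)]
  simp only [← Finset.compl_eq_univ_sdiff]
  refine Finset.sum_subset ?_ ?_
  · intro I hI
    obtain ⟨-, ⟨hI, -, -⟩, hp⟩ := Finset.mem_filter.1 hI
    exact Finset.mem_filter.2
      ⟨mem_ideals.2 ⟨Finset.subset_univ I, fun x hx y _ hxy => hI x hx y hxy⟩, hp⟩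
  · intro I hI hI'
    obtain ⟨hI, hp⟩ := Finset.mem_filter.1 hI
    obtain rfl | h₁ := I.eq_empty_or_nonempty
    · simp
    obtain h | h₂ := Iᶜ.eq_empty_or_nonempty
    · simp [h]
    · exact absurd (Finset.mem_filter.2 ⟨Finset.mem_univ _, ⟨fun x hx y hxy =>
        (mem_ideals.1 hI).2 x hx y (Finset.mem_univ y) hxy, h₁, h₂⟩, hp⟩) hI'

theorem prec_single (P : SpecialPoset) : (ops K).prec (Finsupp.single P 1) =
    ∑ I ∈ ideals P.le Finset.univ with P.top ∉ I,
      cls K P.le (Finset.univ \ I) ⊗ₜ[K] cls K P.le I := by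
  classical
  rw [← sum_nontrivialIdeal P fun I => P.top ∉ I]
  simp only [ops, Finsupp.linearCombination_single, one_smul, cls_restrict]

theorem succ_single (P : SpecialPoset) : (ops K).succ (Finsupp.single P 1) =
    ∑ I ∈ ideals P.le Finset.univ with P.top ∈ I,
      cls K P.le (Finset.univ \ I) ⊗ₜ[K] cls K P.le I := by
  classical
  rw [← sum_nontrivialIdeal P fun I => P.top ∈ I]
  simp only [ops, Finsupp.linearCombination_single, one_smul, cls_restrict]

section coproducts

variable {P : SpecialPoset} {q : γ → γ → Prop} {S : Finset γ} {f : Fin P.n → γ}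

theorem Represents.cls_image (h : Represents P q S f) (I : Finset (Fin P.n)) :
    cls K q (I.image f) = cls K P.le I :=
  cls_congr (P.isOrderOn I) f (fun _ _ _ _ h' => h.strictMono h') fun _ _ _ _ => h.le_iff _ _

theorem Represents.sum_ideals (h : Represents P q S f) {M : Type*} [AddCommMonoid M]
    (F : Finset γ → M) :
    ∑ I ∈ ideals P.le Finset.univ, F (I.image f) = ∑ I ∈ ideals q S, F I := by
  refine Finset.sum_nbij (fun I => I.image f) ?_ ?_ ?_ fun _ _ => rfl
  · intro I hI
    rw [mem_ideals] at hI ⊢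
    refine ⟨by rw [← h.image_eq]; exact Finset.image_subset_image hI.1, ?_⟩
    intro x hx y hy hxy
    obtain ⟨i, hi, rfl⟩ := Finset.mem_image.1 hx
    obtain ⟨j, rfl⟩ := h.exists_eq hy
    exact Finset.mem_image_of_mem _ (hI.2 i hi j (Finset.mem_univ j) ((h.le_iff i j).2 hxy))
  · exact (Finset.image_injective h.strictMono.injective).injOn
  · intro J hJ
    rw [Finset.mem_coe, mem_ideals] at hJ
    refine ⟨Finset.univ.filter fun i => f i ∈ J, ?_, ?_⟩
    · rw [Finset.mem_coe, mem_ideals]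
      refine ⟨Finset.subset_univ _, ?_⟩
      simp only [Finset.mem_filter, Finset.mem_univ, true_and, forall_const]
      exact fun i hi j hij => hJ.2 _ hi _ (h.mem j) ((h.le_iff i j).1 hij)
    · ext x
      simp only [Finset.mem_image, Finset.mem_filter, Finset.mem_univ, true_and]
      constructor
      · rintro ⟨i, hi, rfl⟩
        exact hi
      · intro hx
        obtain ⟨i, rfl⟩ := h.exists_eq (hJ.1 hx)
        exact ⟨i, hx, rfl⟩

theorem prec_cls (hq : IsOrderOn q S) {m : γ} (hm : IsGreatest (S : Set γ) m) :
    (ops K).prec (cls K q S) =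
      ∑ I ∈ ideals q S with m ∉ I, cls K q (S \ I) ⊗ₜ[K] cls K q I := by
  obtain ⟨P, f, h⟩ := exists_represents ⟨m, hm.1⟩ hq
  obtain rfl := hm.unique h.isGreatest
  rw [h.cls_eq, prec_single, Finset.sum_filter, Finset.sum_filter, ← h.sum_ideals]
  refine Finset.sum_congr rfl fun I _ => ?_
  rw [← h.image_eq, ← Finset.image_sdiff _ _ h.strictMono.injective, h.cls_image, h.cls_image]
  simp [h.strictMono.injective.eq_iff]

theorem succ_cls (hq : IsOrderOn q S) {m : γ} (hm : IsGreatest (S : Set γ) m) :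
    (ops K).succ (cls K q S) =
      ∑ I ∈ ideals q S with m ∈ I, cls K q (S \ I) ⊗ₜ[K] cls K q I := by
  obtain ⟨P, f, h⟩ := exists_represents ⟨m, hm.1⟩ hq
  obtain rfl := hm.unique h.isGreatest
  rw [h.cls_eq, succ_single, Finset.sum_filter, Finset.sum_filter, ← h.sum_ideals]
  refine Finset.sum_congr rfl fun I _ => ?_
  rw [← h.image_eq, ← Finset.image_sdiff _ _ h.strictMono.injective, h.cls_image, h.cls_image]
  simp [h.strictMono.injective.eq_iff]

/-- The two conditions on the greatest element are complementary. The empty set, which has no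
greatest element, gives zero on both sides; it must be allowed because the ideals and complements
met below can be empty. -/
theorem red_cls (hq : IsOrderOn q S) :
    (ops K).red (cls K q S) = ∑ I ∈ ideals q S, cls K q (S \ I) ⊗ₜ[K] cls K q I := by
  obtain rfl | hS := S.eq_empty_or_nonempty
  · symm
    simp only [cls_empty, map_zero, Finset.empty_sdiff, TensorProduct.zero_tmul,
      Finset.sum_const_zero]
  · have hm := S.isGreatest_max' hS
    rw [DupDendOps.red, LinearMap.add_apply, prec_cls hq hm, succ_cls hq hm, add_comm,
      Finset.sum_filter_add_sum_filter_not]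

end coproducts

/-! ### The dendriform axioms -/

/-- Pairs of nested ideals, described from above or from below. -/
theorem sum_ideals_sdiff {q : γ → γ → Prop} {S : Finset γ} {M : Type*} [AddCommMonoid M]
    (F : Finset γ → Finset γ → Finset γ → M) :
    ∑ I ∈ ideals q S, ∑ J ∈ ideals q (S \ I), F ((S \ I) \ J) J I =
      ∑ I ∈ ideals q S, ∑ J ∈ ideals q I, F (S \ I) (I \ J) J := by
  rw [Finset.sum_sigma', Finset.sum_sigma']
  -- An ideal `J` of the complement of an ideal `I` gives the larger ideal `I ∪ J`, in which `I` is
  -- an ideal; conversely the middle block is the difference of the two ideals.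
  refine Finset.sum_nbij' (fun x => ⟨x.1 ∪ x.2, x.1⟩) (fun x => ⟨x.2, x.1 \ x.2⟩) ?_ ?_ ?_ ?_ ?_
  · rintro ⟨I, J⟩
    simp only [Finset.mem_sigma, mem_ideals, Finset.subset_iff]
    grind
  · rintro ⟨I, J⟩
    simp only [Finset.mem_sigma, mem_ideals, Finset.subset_iff]
    grind
  · rintro ⟨I, J⟩
    simp only [Finset.mem_sigma, mem_ideals]
    rintro ⟨-, h, -⟩
    have : (I ∪ J) \ I = J := by grind
    rw [this]
  · rintro ⟨I, J⟩
    simp only [Finset.mem_sigma, mem_ideals]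
    rintro ⟨-, h, -⟩
    have : J ∪ I \ J = I := by grind
    rw [this]
  · rintro ⟨I, J⟩
    simp only [Finset.mem_sigma, mem_ideals]
    rintro ⟨-, h, -⟩
    have h₁ : (S \ I) \ J = S \ (I ∪ J) := by grind
    have h₂ : (I ∪ J) \ I = J := by grind
    rw [h₁, h₂]

theorem isGreatest_of_mem {S T : Finset γ} {m : γ} (hm : IsGreatest (S : Set γ) m) (hT : T ⊆ S)
    (h : m ∈ T) : IsGreatest (T : Set γ) m :=
  ⟨h, fun _ hx => hm.2 (hT hx)⟩

section dendriform

variable {q : γ → γ → Prop} {S : Finset γ}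

/-- Both sides run over the partitions of `S` cut out by two nested ideals, with `m` in the first
block. The other two axioms are the same count with `m` in the middle block (`succ_prec_cls`) or in
the last one (`red_succ_cls`), whence the indicator in `h` each time. -/
theorem prec_prec_cls (hq : IsOrderOn q S) {m : γ} (hm : IsGreatest (S : Set γ) m) :
    TensorProduct.assoc K _ _ _ ((ops K).prec.rTensor _ ((ops K).prec (cls K q S))) =
      (ops K).red.lTensor _ ((ops K).prec (cls K q S)) := by
  have h := sum_ideals_sdiff (q := q) (S := S) fun A B C =>
    if m ∈ A then cls K q A ⊗ₜ[K] (cls K q B ⊗ₜ[K] cls K q C) else 0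
  rw [prec_cls hq hm, Finset.sum_filter, map_sum, map_sum, map_sum]
  convert h using 1
  · refine Finset.sum_congr rfl fun I hI => ?_
    by_cases hmI : m ∉ I
    · have hmS : m ∈ S \ I := Finset.mem_sdiff.2 ⟨hm.1, hmI⟩
      rw [if_pos hmI, LinearMap.rTensor_tmul, prec_cls (hq.mono Finset.sdiff_subset)
        (isGreatest_of_mem hm Finset.sdiff_subset hmS), TensorProduct.sum_tmul, map_sum,
        Finset.sum_filter]
      refine Finset.sum_congr rfl fun J _ => ?_
      simp [hmS]
    · rw [if_neg hmI, map_zero, map_zero]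
      refine (Finset.sum_eq_zero fun J _ => if_neg ?_).symm
      grind
  · refine Finset.sum_congr rfl fun I hI => ?_
    have hIS := (mem_ideals.1 hI).1
    by_cases hmI : m ∉ I
    · simp only [Finset.mem_sdiff.2 ⟨hm.1, hmI⟩, if_true]
      rw [if_pos hmI, LinearMap.lTensor_tmul, red_cls (hq.mono hIS), TensorProduct.tmul_sum]
    · simp [hmI]

theorem succ_prec_cls (hq : IsOrderOn q S) {m : γ} (hm : IsGreatest (S : Set γ) m) :
    TensorProduct.assoc K _ _ _ ((ops K).succ.rTensor _ ((ops K).prec (cls K q S))) =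
      (ops K).prec.lTensor _ ((ops K).succ (cls K q S)) := by
  have h := sum_ideals_sdiff (q := q) (S := S) fun A B C =>
    if m ∈ B then cls K q A ⊗ₜ[K] (cls K q B ⊗ₜ[K] cls K q C) else 0
  rw [prec_cls hq hm, succ_cls hq hm, Finset.sum_filter, Finset.sum_filter, map_sum, map_sum,
    map_sum]
  convert h using 1
  · refine Finset.sum_congr rfl fun I hI => ?_
    by_cases hmI : m ∉ I
    · have hmS : m ∈ S \ I := Finset.mem_sdiff.2 ⟨hm.1, hmI⟩
      rw [if_pos hmI, LinearMap.rTensor_tmul, succ_cls (hq.mono Finset.sdiff_subset)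
        (isGreatest_of_mem hm Finset.sdiff_subset hmS), TensorProduct.sum_tmul, map_sum,
        Finset.sum_filter]
      refine Finset.sum_congr rfl fun J _ => ?_
      split_ifs <;> simp
    · rw [if_neg hmI, map_zero, map_zero]
      refine (Finset.sum_eq_zero fun J hJ => if_neg ?_).symm
      have := (mem_ideals.1 hJ).1
      grind
  · refine Finset.sum_congr rfl fun I hI => ?_
    have hIS := (mem_ideals.1 hI).1
    split_ifs with hmI
    · rw [LinearMap.lTensor_tmul, prec_cls (hq.mono hIS) (isGreatest_of_mem hm hIS hmI),
        TensorProduct.tmul_sum, Finset.sum_filter]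
      refine Finset.sum_congr rfl fun J _ => ?_
      simp [hmI]
    · rw [map_zero]
      refine (Finset.sum_eq_zero fun J hJ => if_neg ?_).symm
      grind

theorem red_succ_cls (hq : IsOrderOn q S) {m : γ} (hm : IsGreatest (S : Set γ) m) :
    TensorProduct.assoc K _ _ _ ((ops K).red.rTensor _ ((ops K).succ (cls K q S))) =
      (ops K).succ.lTensor _ ((ops K).succ (cls K q S)) := by
  have h := sum_ideals_sdiff (q := q) (S := S) fun A B C =>
    if m ∈ C then cls K q A ⊗ₜ[K] (cls K q B ⊗ₜ[K] cls K q C) else 0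
  rw [succ_cls hq hm, Finset.sum_filter, map_sum, map_sum, map_sum]
  convert h using 1
  · refine Finset.sum_congr rfl fun I hI => ?_
    split_ifs with hmI
    · rw [LinearMap.rTensor_tmul, red_cls (hq.mono Finset.sdiff_subset), TensorProduct.sum_tmul,
        map_sum]
      simp
    · simp
  · refine Finset.sum_congr rfl fun I hI => ?_
    have hIS := (mem_ideals.1 hI).1
    split_ifs with hmI
    · rw [LinearMap.lTensor_tmul, succ_cls (hq.mono hIS) (isGreatest_of_mem hm hIS hmI),
        TensorProduct.tmul_sum, Finset.sum_filter]
    · rw [map_zero]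
      refine (Finset.sum_eq_zero fun J hJ => if_neg ?_).symm
      exact fun h => hmI ((mem_ideals.1 hJ).1 h)

end dendriform

theorem linearMap_ext {M : Type*} [AddCommMonoid M] [Module K M] {φ ψ : HSPPlus K →ₗ[K] M}
    (h : ∀ P, φ (Finsupp.single P 1) = ψ (Finsupp.single P 1)) : φ = ψ :=
  Finsupp.lhom_ext' fun P => LinearMap.ext_ring (h P)

theorem isDendriform : (ops K).IsDendriform where
  prec_prec := by
    refine LinearMap.congr_fun (f := (TensorProduct.assoc K _ _ _).toLinearMap ∘ₗ
      (ops K).prec.rTensor _ ∘ₗ (ops K).prec) (g := (ops K).red.lTensor _ ∘ₗ (ops K).prec) ?_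
    refine linearMap_ext fun P => ?_
    rw [← cls_univ]
    exact prec_prec_cls (P.isOrderOn _) (represents_self P).isGreatest
  succ_prec := by
    refine LinearMap.congr_fun (f := (TensorProduct.assoc K _ _ _).toLinearMap ∘ₗ
      (ops K).succ.rTensor _ ∘ₗ (ops K).prec) (g := (ops K).prec.lTensor _ ∘ₗ (ops K).succ) ?_
    refine linearMap_ext fun P => ?_
    rw [← cls_univ]
    exact succ_prec_cls (P.isOrderOn _) (represents_self P).isGreatest
  red_succ := by
    refine LinearMap.congr_fun (f := (TensorProduct.assoc K _ _ _).toLinearMap ∘ₗ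
      (ops K).red.rTensor _ ∘ₗ (ops K).succ) (g := (ops K).succ.lTensor _ ∘ₗ (ops K).succ) ?_
    refine linearMap_ext fun P => ?_
    rw [← cls_univ]
    exact red_succ_cls (P.isOrderOn _) (represents_self P).isGreatest

end HSPPlus

namespace HSPPlus

variable {γ : Type*} [LinearOrder γ] {K : Type*} [Field K]

/-! ### Nontrivial ideals -/

/-- The ideals of `S` other than `∅` and `S`. -/
noncomputable def properIdeals (q : γ → γ → Prop) (S : Finset γ) : Finset (Finset γ) :=
  ((ideals q S).erase ∅).erase S

theorem mem_properIdeals {q : γ → γ → Prop} {S I : Finset γ} :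
    I ∈ properIdeals q S ↔ I ∈ ideals q S ∧ I.Nonempty ∧ (S \ I).Nonempty := by
  rw [properIdeals, Finset.mem_erase, Finset.mem_erase, Finset.sdiff_nonempty,
    Finset.nonempty_iff_ne_empty]
  constructor
  · rintro ⟨h₁, h₂, h₃⟩
    exact ⟨h₃, h₂, fun h => h₁ ((mem_ideals.1 h₃).1.antisymm h)⟩
  · rintro ⟨h₁, h₂, h₃⟩
    exact ⟨fun h => h₃ h.ge, h₂, h₁⟩

section sums

variable {q : γ → γ → Prop} {S T : Finset γ} {M : Type*} [AddCommMonoid M]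

/-- For nonempty `S` the two trivial ideals are distinct. Isolating them for each factor of a
product produces the terms of the compatibility axioms in which that factor is not cut. -/
theorem sum_ideals_eq (hS : S.Nonempty) (F : Finset γ → M) :
    ∑ I ∈ ideals q S, F I = F ∅ + (F S + ∑ I ∈ properIdeals q S, F I) := by
  rw [properIdeals, Finset.add_sum_erase _ _
    (Finset.mem_erase.2 ⟨hS.ne_empty, self_mem_ideals q S⟩),
    Finset.add_sum_erase _ _ (empty_mem_ideals q S)]

theorem sum_ideals_notMem {m : γ} (hm : m ∈ S) (F : Finset γ → M) :
    ∑ I ∈ ideals q S with m ∉ I, F I = F ∅ + ∑ I ∈ properIdeals q S with m ∉ I, F I := by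
  rw [Finset.sum_filter, Finset.sum_filter, sum_ideals_eq ⟨m, hm⟩]
  simp [hm]

theorem sum_ideals_mem {m : γ} (hm : m ∈ S) (F : Finset γ → M) :
    ∑ I ∈ ideals q S with m ∈ I, F I = F S + ∑ I ∈ properIdeals q S with m ∈ I, F I := by
  rw [Finset.sum_filter, Finset.sum_filter, sum_ideals_eq ⟨m, hm⟩]
  simp [hm]

theorem red_cls' (hq : IsOrderOn q S) (hS : S.Nonempty) : (ops K).red (cls K q S) =
    ∑ I ∈ properIdeals q S, cls K q (S \ I) ⊗ₜ[K] cls K q I := by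
  rw [red_cls hq, sum_ideals_eq hS]
  simp

theorem prec_cls' (hq : IsOrderOn q S) {m : γ} (hm : IsGreatest (S : Set γ) m) :
    (ops K).prec (cls K q S) =
      ∑ I ∈ properIdeals q S with m ∉ I, cls K q (S \ I) ⊗ₜ[K] cls K q I := by
  rw [prec_cls hq hm, sum_ideals_notMem hm.1]
  simp

theorem succ_cls' (hq : IsOrderOn q S) {m : γ} (hm : IsGreatest (S : Set γ) m) :
    (ops K).succ (cls K q S) =
      ∑ I ∈ properIdeals q S with m ∈ I, cls K q (S \ I) ⊗ₜ[K] cls K q I := by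
  rw [succ_cls hq hm, sum_ideals_mem hm.1]
  simp

/-- In the absence of relations between `S` and `T`, an ideal of the union is determined by its two
traces, which are independent ideals. -/
theorem sum_ideals_union_of_mul (hd : Disjoint S T) (h₁ : ∀ x ∈ S, ∀ y ∈ T, ¬ q x y)
    (h₂ : ∀ x ∈ S, ∀ y ∈ T, ¬ q y x) (F : Finset γ → M) :
    ∑ I ∈ ideals q (S ∪ T), F I = ∑ I ∈ ideals q S, ∑ J ∈ ideals q T, F (I ∪ J) := by
  rw [Finset.sum_sigma']
  rw [Finset.disjoint_left] at hd
  refine Finset.sum_nbij' (fun I => ⟨I ∩ S, I ∩ T⟩) (fun x => x.1 ∪ x.2) ?_ ?_ ?_ ?_ ?_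
  · intro I
    simp only [Finset.mem_sigma, mem_ideals, Finset.subset_iff]
    grind
  · rintro ⟨I, J⟩
    simp only [Finset.mem_sigma, mem_ideals, Finset.subset_iff]
    grind
  · intro I
    simp only [mem_ideals, Finset.subset_iff]
    grind
  · rintro ⟨I, J⟩
    simp only [Finset.mem_sigma, mem_ideals, Finset.subset_iff]
    rintro ⟨⟨hI, -⟩, hJ, -⟩
    have e₁ : (I ∪ J) ∩ S = I := by grind
    have e₂ : (I ∪ J) ∩ T = J := by grind
    rw [e₁, e₂]
  · intro I
    simp only [mem_ideals, Finset.subset_iff]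
    rintro ⟨hI, -⟩
    congr 1
    grind

/-- As `m` is below every element of `T`, an ideal containing `m` contains `T`. If an ideal misses
`m`, none of its elements in `S` is below `m`, hence none is below an element of `T`, and the traces
on `S` and `T` are independent. -/
theorem sum_ideals_union_of_nw (hd : Disjoint S T) {m : γ} (hm : m ∈ S) (hmm : q m m)
    (h₁ : ∀ x ∈ S, ∀ y ∈ T, (q x y ↔ q x m))
    (h₂ : ∀ x ∈ S, ∀ y ∈ T, ¬ q y x) (F : Finset γ → M) :
    ∑ I ∈ ideals q (S ∪ T), F I = ∑ I ∈ ideals q S with m ∈ I, F (I ∪ T) +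
      ∑ I ∈ ideals q S with m ∉ I, ∑ J ∈ ideals q T, F (I ∪ J) := by
  rw [← Finset.sum_filter_add_sum_filter_not _ (fun I => m ∈ I)]
  rw [Finset.disjoint_left] at hd
  congr 1
  · refine Finset.sum_nbij' (fun I => I ∩ S) (fun I => I ∪ T) ?_ ?_ ?_ ?_ ?_
    · intro I
      simp only [Finset.mem_filter, mem_ideals, Finset.subset_iff]
      grind
    · intro I
      simp only [Finset.mem_filter, mem_ideals, Finset.subset_iff]
      grind
    · intro I
      simp only [Finset.mem_filter, mem_ideals, Finset.subset_iff]
      intro h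
      have : ∀ y ∈ T, y ∈ I := fun y hy =>
        h.1.2 m h.2 y (Finset.mem_union_right _ hy) ((h₁ m hm y hy).2 hmm)
      grind
    · intro I
      simp only [Finset.mem_filter, mem_ideals, Finset.subset_iff]
      grind
    · intro I
      simp only [Finset.mem_filter, mem_ideals, Finset.subset_iff]
      intro h
      have : ∀ y ∈ T, y ∈ I := fun y hy =>
        h.1.2 m h.2 y (Finset.mem_union_right _ hy) ((h₁ m hm y hy).2 hmm)
      congr 1
      grind
  · rw [Finset.sum_sigma']
    refine Finset.sum_nbij' (fun I => ⟨I ∩ S, I ∩ T⟩) (fun x => x.1 ∪ x.2) ?_ ?_ ?_ ?_ ?_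
    · intro I
      simp only [Finset.mem_filter, Finset.mem_sigma, mem_ideals, Finset.subset_iff]
      grind
    · rintro ⟨I, J⟩
      simp only [Finset.mem_filter, Finset.mem_sigma, mem_ideals, Finset.subset_iff]
      rintro ⟨⟨⟨hI, hI'⟩, hmI⟩, hJ, hJ'⟩
      have h₃ : ∀ x ∈ I, ∀ y ∈ T, ¬ q x y := fun x hx y hy hxy =>
        hmI (hI' x hx m hm ((h₁ x (hI hx) y hy).1 hxy))
      grind
    · intro I
      simp only [Finset.mem_filter, mem_ideals, Finset.subset_iff]
      grind
    · rintro ⟨I, J⟩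
      simp only [Finset.mem_filter, Finset.mem_sigma, mem_ideals, Finset.subset_iff]
      rintro ⟨⟨⟨hI, -⟩, -⟩, hJ, -⟩
      have e₁ : (I ∪ J) ∩ S = I := by grind
      have e₂ : (I ∪ J) ∩ T = J := by grind
      rw [e₁, e₂]
    · intro I
      simp only [Finset.mem_filter, mem_ideals, Finset.subset_iff]
      rintro ⟨⟨hI, -⟩, -⟩
      congr 1
      grind

end sums

theorem union_sdiff_union {S T I J : Finset γ} (hd : Disjoint S T) (hI : I ⊆ S) (hJ : J ⊆ T) :
    (S ∪ T) \ (I ∪ J) = (S \ I) ∪ (T \ J) := by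
  rw [Finset.disjoint_left] at hd
  ext x
  have := @hI x
  have := @hJ x
  have := @hd x
  simp only [Finset.mem_sdiff, Finset.mem_union]
  tauto

/-! ### Compatibility with the composition -/

/-- The finite set `S ∪ T` carries the composition of the special posets `S` and `T`. -/
structure IsMul (q : γ → γ → Prop) (S T : Finset γ) : Prop where
  left : S.Nonempty
  right : T.Nonempty
  isOrderOn : IsOrderOn q (S ∪ T)
  lt : ∀ x ∈ S, ∀ y ∈ T, x < y
  not_le : ∀ x ∈ S, ∀ y ∈ T, ¬ q x y
  not_ge : ∀ x ∈ S, ∀ y ∈ T, ¬ q y x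

/-- The finite set `S ∪ T` carries the special poset `S ↖ T`, `m` being the greatest element
of `S`. -/
structure IsNw (q : γ → γ → Prop) (S T : Finset γ) (m : γ) : Prop where
  left : IsGreatest (S : Set γ) m
  right : T.Nonempty
  isOrderOn : IsOrderOn q (S ∪ T)
  lt : ∀ x ∈ S, ∀ y ∈ T, x < y
  le_iff : ∀ x ∈ S, ∀ y ∈ T, (q x y ↔ q x m)
  not_ge : ∀ x ∈ S, ∀ y ∈ T, ¬ q y x

theorem disjoint_of_lt {S T : Finset γ} (h : ∀ x ∈ S, ∀ y ∈ T, x < y) : Disjoint S T :=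
  Finset.disjoint_left.2 fun x hx hx' => lt_irrefl x (h x hx x hx')

theorem isGreatest_union {S T : Finset γ} (h : ∀ x ∈ S, ∀ y ∈ T, x < y) {m : γ}
    (hm : IsGreatest (T : Set γ) m) : IsGreatest ((S ∪ T : Finset γ) : Set γ) m := by
  refine ⟨Finset.mem_coe.2 (Finset.mem_union_right _ hm.1), fun x hx => ?_⟩
  rcases Finset.mem_union.1 hx with hx | hx
  · exact (h x hx m hm.1).le
  · exact hm.2 hx

section compatibility

variable {q : γ → γ → Prop} {S T I J : Finset γ}

theorem IsMul.mul (h : IsMul q S T) :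
    (ops K).mul (cls K q S) (cls K q T) = cls K q (S ∪ T) :=
  mul_cls h.left h.right (h.isOrderOn.mono Finset.subset_union_left)
    (h.isOrderOn.mono Finset.subset_union_right) h.lt h.not_le h.not_ge

theorem IsNw.nw {m : γ} (h : IsNw q S T m) :
    (ops K).nw (cls K q S) (cls K q T) = cls K q (S ∪ T) :=
  nw_cls h.right (h.isOrderOn.mono Finset.subset_union_left)
    (h.isOrderOn.mono Finset.subset_union_right) h.lt h.left h.le_iff h.not_ge

theorem IsMul.mono (h : IsMul q S T) (hI : I ⊆ S) (hJ : J ⊆ T) (hI' : I.Nonempty)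
    (hJ' : J.Nonempty) : IsMul q I J where
  left := hI'
  right := hJ'
  isOrderOn := h.isOrderOn.mono (Finset.union_subset_union hI hJ)
  lt x hx y hy := h.lt x (hI hx) y (hJ hy)
  not_le x hx y hy := h.not_le x (hI hx) y (hJ hy)
  not_ge x hx y hy := h.not_ge x (hI hx) y (hJ hy)

theorem IsNw.mono {m : γ} (h : IsNw q S T m) (hI : I ⊆ S) (hJ : J ⊆ T) (hm : m ∈ I)
    (hJ' : J.Nonempty) : IsNw q I J m where
  left := isGreatest_of_mem h.left hI hm
  right := hJ'
  isOrderOn := h.isOrderOn.mono (Finset.union_subset_union hI hJ)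
  lt x hx y hy := h.lt x (hI hx) y (hJ hy)
  le_iff x hx y hy := h.le_iff x (hI hx) y (hJ hy)
  not_ge x hx y hy := h.not_ge x (hI hx) y (hJ hy)

/-- An element of `I` below some element of `T` would be below `m`, forcing `m ∈ I`. This is why
right tensor factors of the coproducts of `x ↖ y` involve the plain product. -/
theorem IsNw.isMul {m : γ} (h : IsNw q S T m) (hI : I ∈ ideals q S) (hJ : J ⊆ T) (hm : m ∉ I)
    (hI' : I.Nonempty) (hJ' : J.Nonempty) : IsMul q I J where
  left := hI'
  right := hJ'
  isOrderOn := h.isOrderOn.mono (Finset.union_subset_union (mem_ideals.1 hI).1 hJ)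
  lt x hx y hy := h.lt x ((mem_ideals.1 hI).1 hx) y (hJ hy)
  not_le x hx y hy hxy := hm ((mem_ideals.1 hI).2 x hx m h.left.1
    ((h.le_iff x ((mem_ideals.1 hI).1 hx) y (hJ hy)).1 hxy))
  not_ge x hx y hy := h.not_ge x ((mem_ideals.1 hI).1 hx) y (hJ hy)

theorem subset_of_mem_properIdeals (hI : I ∈ properIdeals q S) : I ⊆ S :=
  (mem_ideals.1 (mem_properIdeals.1 hI).1).1

/-- Here and in the next rewritings, properness of the ideals is essential: it keeps the parts
nonempty, whereas a product with the class of `∅` would be zero. -/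
theorem IsMul.cls_union_sdiff (h : IsMul q S T) (hJ : J ∈ properIdeals q T) :
    cls K q (S ∪ T \ J) = (ops K).mul (cls K q S) (cls K q (T \ J)) :=
  (h.mono subset_rfl Finset.sdiff_subset h.left (mem_properIdeals.1 hJ).2.2).mul.symm

theorem IsMul.cls_union_right (h : IsMul q S T) (hJ : J ∈ properIdeals q T) :
    cls K q (S ∪ J) = (ops K).mul (cls K q S) (cls K q J) :=
  (h.mono subset_rfl (subset_of_mem_properIdeals hJ) h.left (mem_properIdeals.1 hJ).2.1).mul.symm

theorem IsMul.cls_sdiff_union (h : IsMul q S T) (hI : I ∈ properIdeals q S) :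
    cls K q (S \ I ∪ T) = (ops K).mul (cls K q (S \ I)) (cls K q T) :=
  (h.mono Finset.sdiff_subset subset_rfl (mem_properIdeals.1 hI).2.2 h.right).mul.symm

theorem IsMul.cls_union_left (h : IsMul q S T) (hI : I ∈ properIdeals q S) :
    cls K q (I ∪ T) = (ops K).mul (cls K q I) (cls K q T) :=
  (h.mono (subset_of_mem_properIdeals hI) subset_rfl (mem_properIdeals.1 hI).2.1
    h.right).mul.symm

theorem IsMul.cls_sdiff_union_sdiff (h : IsMul q S T) (hI : I ∈ properIdeals q S)
    (hJ : J ∈ properIdeals q T) :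
    cls K q (S \ I ∪ T \ J) = (ops K).mul (cls K q (S \ I)) (cls K q (T \ J)) :=
  (h.mono Finset.sdiff_subset Finset.sdiff_subset (mem_properIdeals.1 hI).2.2
    (mem_properIdeals.1 hJ).2.2).mul.symm

theorem IsMul.cls_union (h : IsMul q S T) (hI : I ∈ properIdeals q S)
    (hJ : J ∈ properIdeals q T) :
    cls K q (I ∪ J) = (ops K).mul (cls K q I) (cls K q J) :=
  (h.mono (subset_of_mem_properIdeals hI) (subset_of_mem_properIdeals hJ)
    (mem_properIdeals.1 hI).2.1 (mem_properIdeals.1 hJ).2.1).mul.symm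

/-- The greatest element of `S ∪ T` lies in `T`, so only the trace `J` on `T` decides between `Δ_≺`
and `Δ_≻`. -/
theorem IsMul.prec_union (h : IsMul q S T) {m : γ} (hm : IsGreatest (T : Set γ) m) :
    (ops K).prec (cls K q (S ∪ T)) = ∑ I ∈ ideals q S, ∑ J ∈ ideals q T with m ∉ J,
      cls K q (S \ I ∪ T \ J) ⊗ₜ[K] cls K q (I ∪ J) := by
  have hd := disjoint_of_lt h.lt
  rw [prec_cls h.isOrderOn (isGreatest_union h.lt hm), Finset.sum_filter,
    sum_ideals_union_of_mul hd h.not_le h.not_ge]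
  refine Finset.sum_congr rfl fun I hI => ?_
  rw [Finset.sum_filter]
  refine Finset.sum_congr rfl fun J hJ => ?_
  rw [union_sdiff_union hd (mem_ideals.1 hI).1 (mem_ideals.1 hJ).1]
  have : m ∉ I := fun h => Finset.disjoint_right.1 hd hm.1 ((mem_ideals.1 hI).1 h)
  simp [this]

theorem IsMul.succ_union (h : IsMul q S T) {m : γ} (hm : IsGreatest (T : Set γ) m) :
    (ops K).succ (cls K q (S ∪ T)) = ∑ I ∈ ideals q S, ∑ J ∈ ideals q T with m ∈ J,
      cls K q (S \ I ∪ T \ J) ⊗ₜ[K] cls K q (I ∪ J) := by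
  have hd := disjoint_of_lt h.lt
  rw [succ_cls h.isOrderOn (isGreatest_union h.lt hm), Finset.sum_filter,
    sum_ideals_union_of_mul hd h.not_le h.not_ge]
  refine Finset.sum_congr rfl fun I hI => ?_
  rw [Finset.sum_filter]
  refine Finset.sum_congr rfl fun J hJ => ?_
  rw [union_sdiff_union hd (mem_ideals.1 hI).1 (mem_ideals.1 hJ).1]
  have : m ∉ I := fun h => Finset.disjoint_right.1 hd hm.1 ((mem_ideals.1 hI).1 h)
  simp [this]

theorem map₂_sum_tmul {ι κ : Type*} (f g : HSPPlus K →ₗ[K] HSPPlus K →ₗ[K] HSPPlus K)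
    (s : Finset ι) (t : Finset κ) (a b : ι → HSPPlus K) (c d : κ → HSPPlus K) :
    TensorProduct.map₂ f g (∑ i ∈ s, a i ⊗ₜ[K] b i) (∑ j ∈ t, c j ⊗ₜ[K] d j) =
      ∑ i ∈ s, ∑ j ∈ t, f (a i) (c j) ⊗ₜ[K] g (b i) (d j) := by
  rw [map_sum (TensorProduct.map₂ f g), LinearMap.sum_apply]
  refine Finset.sum_congr rfl fun i _ => ?_
  rw [map_sum]
  rfl

theorem rTensor_sum_tmul {ι : Type*} (f : HSPPlus K →ₗ[K] HSPPlus K)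
    (s : Finset ι) (a b : ι → HSPPlus K) :
    f.rTensor (HSPPlus K) (∑ i ∈ s, a i ⊗ₜ[K] b i) = ∑ i ∈ s, f (a i) ⊗ₜ[K] b i :=
  map_sum _ _ _

theorem lTensor_sum_tmul {ι : Type*} (f : HSPPlus K →ₗ[K] HSPPlus K)
    (s : Finset ι) (a b : ι → HSPPlus K) :
    f.lTensor (HSPPlus K) (∑ i ∈ s, a i ⊗ₜ[K] b i) = ∑ i ∈ s, a i ⊗ₜ[K] f (b i) :=
  map_sum _ _ _

/-- Since `m ∉ J`, the ideal `J` is `∅` or proper. For `I = ∅`, proper `J` give `x y' ⊗ y''`, and `J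
= ∅` gives zero. For `I = S`, `J = ∅` gives `y ⊗ x` and proper `J` give `y' ⊗ x y''`. For proper `I`
the two cases are `x' y ⊗ x''` and `x' y' ⊗ x'' y''`. -/
theorem IsMul.prec_mul (h : IsMul q S T) :
    (ops K).prec ((ops K).mul (cls K q S) (cls K q T)) =
      cls K q T ⊗ₜ[K] cls K q S
        + ((ops K).mul (cls K q S)).lTensor _ ((ops K).prec (cls K q T))
        + ((ops K).mul (cls K q S)).rTensor _ ((ops K).prec (cls K q T))
        + ((ops K).mul.flip (cls K q T)).rTensor _ ((ops K).red (cls K q S))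
        + TensorProduct.map₂ (ops K).mul (ops K).mul ((ops K).red (cls K q S))
          ((ops K).prec (cls K q T)) := by
  have hm := T.isGreatest_max' h.right
  set m := T.max' h.right
  rw [h.mul, h.prec_union hm, sum_ideals_eq h.left,
    red_cls' (h.isOrderOn.mono Finset.subset_union_left) h.left,
    prec_cls' (h.isOrderOn.mono Finset.subset_union_right) hm, lTensor_sum_tmul,
    rTensor_sum_tmul, rTensor_sum_tmul, map₂_sum_tmul]
  have e₁ : ∑ J ∈ ideals q T with m ∉ J, cls K q (S \ ∅ ∪ T \ J) ⊗ₜ[K] cls K q (∅ ∪ J) =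
      ∑ J ∈ properIdeals q T with m ∉ J,
        (ops K).mul (cls K q S) (cls K q (T \ J)) ⊗ₜ[K] cls K q J := by
    rw [sum_ideals_notMem hm.1, Finset.union_empty, cls_empty, TensorProduct.tmul_zero, zero_add]
    refine Finset.sum_congr rfl fun J hJ => ?_
    rw [Finset.sdiff_empty, Finset.empty_union, h.cls_union_sdiff (Finset.mem_filter.1 hJ).1]
  have e₂ : ∑ J ∈ ideals q T with m ∉ J, cls K q (S \ S ∪ T \ J) ⊗ₜ[K] cls K q (S ∪ J) =
      cls K q T ⊗ₜ[K] cls K q S + ∑ J ∈ properIdeals q T with m ∉ J,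
        cls K q (T \ J) ⊗ₜ[K] (ops K).mul (cls K q S) (cls K q J) := by
    rw [sum_ideals_notMem hm.1, Finset.union_empty, Finset.sdiff_self, Finset.sdiff_empty,
      Finset.empty_union]
    congr 1
    refine Finset.sum_congr rfl fun J hJ => ?_
    rw [Finset.empty_union, h.cls_union_right (Finset.mem_filter.1 hJ).1]
  have e₃ : ∑ I ∈ properIdeals q S, ∑ J ∈ ideals q T with m ∉ J,
      cls K q (S \ I ∪ T \ J) ⊗ₜ[K] cls K q (I ∪ J) =
      ∑ I ∈ properIdeals q S, (ops K).mul.flip (cls K q T) (cls K q (S \ I)) ⊗ₜ[K] cls K q I +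
        ∑ I ∈ properIdeals q S, ∑ J ∈ properIdeals q T with m ∉ J,
          (ops K).mul (cls K q (S \ I)) (cls K q (T \ J)) ⊗ₜ[K]
            (ops K).mul (cls K q I) (cls K q J) := by
    rw [← Finset.sum_add_distrib]
    refine Finset.sum_congr rfl fun I hI => ?_
    rw [sum_ideals_notMem hm.1, Finset.union_empty, Finset.sdiff_empty, h.cls_sdiff_union hI,
      LinearMap.flip_apply]
    congr 1
    refine Finset.sum_congr rfl fun J hJ => ?_
    have hJ := (Finset.mem_filter.1 hJ).1
    rw [h.cls_sdiff_union_sdiff hI hJ, h.cls_union hI hJ]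
  rw [e₁, e₂, e₃]
  abel

/-- Now `m ∈ J`, so `J` is `T` or proper. The term `x ⊗ y` is `I = ∅`, `J = T`; the pair `I = S`, `J
= T` vanishes; proper `I` with `J = T` gives `x' ⊗ x'' y`. -/
theorem IsMul.succ_mul (h : IsMul q S T) :
    (ops K).succ ((ops K).mul (cls K q S) (cls K q T)) =
      cls K q S ⊗ₜ[K] cls K q T
        + ((ops K).mul (cls K q S)).rTensor _ ((ops K).succ (cls K q T))
        + ((ops K).mul (cls K q S)).lTensor _ ((ops K).succ (cls K q T))
        + ((ops K).mul.flip (cls K q T)).lTensor _ ((ops K).red (cls K q S))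
        + TensorProduct.map₂ (ops K).mul (ops K).mul ((ops K).red (cls K q S))
          ((ops K).succ (cls K q T)) := by
  have hm := T.isGreatest_max' h.right
  set m := T.max' h.right
  rw [h.mul, h.succ_union hm, sum_ideals_eq h.left,
    red_cls' (h.isOrderOn.mono Finset.subset_union_left) h.left,
    succ_cls' (h.isOrderOn.mono Finset.subset_union_right) hm, lTensor_sum_tmul,
    rTensor_sum_tmul, lTensor_sum_tmul, map₂_sum_tmul]
  have e₁ : ∑ J ∈ ideals q T with m ∈ J, cls K q (S \ ∅ ∪ T \ J) ⊗ₜ[K] cls K q (∅ ∪ J) =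
      cls K q S ⊗ₜ[K] cls K q T + ∑ J ∈ properIdeals q T with m ∈ J,
        (ops K).mul (cls K q S) (cls K q (T \ J)) ⊗ₜ[K] cls K q J := by
    rw [sum_ideals_mem hm.1, Finset.empty_union, Finset.sdiff_self, Finset.sdiff_empty,
      Finset.union_empty]
    congr 1
    refine Finset.sum_congr rfl fun J hJ => ?_
    rw [Finset.empty_union, h.cls_union_sdiff (Finset.mem_filter.1 hJ).1]
  have e₂ : ∑ J ∈ ideals q T with m ∈ J, cls K q (S \ S ∪ T \ J) ⊗ₜ[K] cls K q (S ∪ J) =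
      ∑ J ∈ properIdeals q T with m ∈ J,
        cls K q (T \ J) ⊗ₜ[K] (ops K).mul (cls K q S) (cls K q J) := by
    rw [sum_ideals_mem hm.1, Finset.sdiff_self, Finset.sdiff_self, Finset.empty_union, cls_empty,
      TensorProduct.zero_tmul, zero_add]
    refine Finset.sum_congr rfl fun J hJ => ?_
    rw [Finset.empty_union, h.cls_union_right (Finset.mem_filter.1 hJ).1]
  have e₃ : ∑ I ∈ properIdeals q S, ∑ J ∈ ideals q T with m ∈ J,
      cls K q (S \ I ∪ T \ J) ⊗ₜ[K] cls K q (I ∪ J) =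
      ∑ I ∈ properIdeals q S, cls K q (S \ I) ⊗ₜ[K] (ops K).mul.flip (cls K q T) (cls K q I) +
        ∑ I ∈ properIdeals q S, ∑ J ∈ properIdeals q T with m ∈ J,
          (ops K).mul (cls K q (S \ I)) (cls K q (T \ J)) ⊗ₜ[K]
            (ops K).mul (cls K q I) (cls K q J) := by
    rw [← Finset.sum_add_distrib]
    refine Finset.sum_congr rfl fun I hI => ?_
    rw [sum_ideals_mem hm.1, Finset.sdiff_self, Finset.union_empty, h.cls_union_left hI,
      LinearMap.flip_apply]
    congr 1
    refine Finset.sum_congr rfl fun J hJ => ?_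
    have hJ := (Finset.mem_filter.1 hJ).1
    rw [h.cls_sdiff_union_sdiff hI hJ, h.cls_union hI hJ]
  rw [e₁, e₂, e₃]
  abel

/-! ### Compatibility with `↖` -/

theorem IsNw.cls_union_sdiff {n : γ} (h : IsNw q S T n) (hJ : J ∈ properIdeals q T) :
    cls K q (S ∪ T \ J) = (ops K).nw (cls K q S) (cls K q (T \ J)) :=
  (h.mono subset_rfl Finset.sdiff_subset h.left.1 (mem_properIdeals.1 hJ).2.2).nw.symm

theorem IsNw.cls_sdiff_union {n : γ} (h : IsNw q S T n) (hn : n ∉ I) :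
    cls K q (S \ I ∪ T) = (ops K).nw (cls K q (S \ I)) (cls K q T) :=
  (h.mono Finset.sdiff_subset subset_rfl (Finset.mem_sdiff.2 ⟨h.left.1, hn⟩) h.right).nw.symm

theorem IsNw.cls_union_left {n : γ} (h : IsNw q S T n) (hI : I ∈ properIdeals q S)
    (hn : n ∈ I) : cls K q (I ∪ T) = (ops K).nw (cls K q I) (cls K q T) :=
  (h.mono (subset_of_mem_properIdeals hI) subset_rfl hn h.right).nw.symm

theorem IsNw.cls_union_left' {n : γ} (h : IsNw q S T n) (hI : I ∈ properIdeals q S)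
    (hn : n ∉ I) : cls K q (I ∪ T) = (ops K).mul (cls K q I) (cls K q T) :=
  (h.isMul (mem_properIdeals.1 hI).1 subset_rfl hn (mem_properIdeals.1 hI).2.1 h.right).mul.symm

theorem IsNw.cls_sdiff_union_sdiff {n : γ} (h : IsNw q S T n) (hn : n ∉ I)
    (hJ : J ∈ properIdeals q T) :
    cls K q (S \ I ∪ T \ J) = (ops K).nw (cls K q (S \ I)) (cls K q (T \ J)) :=
  (h.mono Finset.sdiff_subset Finset.sdiff_subset (Finset.mem_sdiff.2 ⟨h.left.1, hn⟩)
    (mem_properIdeals.1 hJ).2.2).nw.symm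

theorem IsNw.cls_union {n : γ} (h : IsNw q S T n) (hI : I ∈ properIdeals q S) (hn : n ∉ I)
    (hJ : J ∈ properIdeals q T) :
    cls K q (I ∪ J) = (ops K).mul (cls K q I) (cls K q J) :=
  (h.isMul (mem_properIdeals.1 hI).1 (subset_of_mem_properIdeals hJ) hn
    (mem_properIdeals.1 hI).2.1 (mem_properIdeals.1 hJ).2.1).mul.symm

/-- An ideal containing `n` contains all of `T`, in particular `m`, and so does not occur in `Δ_≺`.
-/
theorem IsNw.prec_union {n : γ} (h : IsNw q S T n) {m : γ} (hm : IsGreatest (T : Set γ) m) :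
    (ops K).prec (cls K q (S ∪ T)) = ∑ I ∈ ideals q S with n ∉ I, ∑ J ∈ ideals q T with m ∉ J,
      cls K q (S \ I ∪ T \ J) ⊗ₜ[K] cls K q (I ∪ J) := by
  have hd := disjoint_of_lt h.lt
  rw [prec_cls h.isOrderOn (isGreatest_union h.lt hm), Finset.sum_filter,
    sum_ideals_union_of_nw hd h.left.1
      (h.isOrderOn.refl n (Finset.mem_union_left _ h.left.1)) h.le_iff h.not_ge,
    Finset.sum_eq_zero, zero_add]
  · refine Finset.sum_congr rfl fun I hI => ?_
    have hI := (mem_ideals.1 (Finset.mem_filter.1 hI).1).1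
    rw [Finset.sum_filter]
    refine Finset.sum_congr rfl fun J hJ => ?_
    rw [union_sdiff_union hd hI (mem_ideals.1 hJ).1]
    have : m ∉ I := fun h => Finset.disjoint_right.1 hd hm.1 (hI h)
    simp [this]
  · exact fun I _ => if_neg fun h => h (Finset.mem_union_right _ hm.1)

theorem IsNw.succ_union {n : γ} (h : IsNw q S T n) {m : γ} (hm : IsGreatest (T : Set γ) m) :
    (ops K).succ (cls K q (S ∪ T)) =
      ∑ I ∈ ideals q S with n ∈ I, cls K q (S \ I) ⊗ₜ[K] cls K q (I ∪ T) +
      ∑ I ∈ ideals q S with n ∉ I, ∑ J ∈ ideals q T with m ∈ J,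
        cls K q (S \ I ∪ T \ J) ⊗ₜ[K] cls K q (I ∪ J) := by
  have hd := disjoint_of_lt h.lt
  rw [succ_cls h.isOrderOn (isGreatest_union h.lt hm), Finset.sum_filter,
    sum_ideals_union_of_nw hd h.left.1
      (h.isOrderOn.refl n (Finset.mem_union_left _ h.left.1)) h.le_iff h.not_ge]
  congr 1
  · refine Finset.sum_congr rfl fun I hI => ?_
    have hI := (mem_ideals.1 (Finset.mem_filter.1 hI).1).1
    rw [if_pos (Finset.mem_union_right _ hm.1), union_sdiff_union hd hI subset_rfl,
      Finset.sdiff_self, Finset.union_empty]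
  · refine Finset.sum_congr rfl fun I hI => ?_
    have hI := (mem_ideals.1 (Finset.mem_filter.1 hI).1).1
    rw [Finset.sum_filter]
    refine Finset.sum_congr rfl fun J hJ => ?_
    rw [union_sdiff_union hd hI (mem_ideals.1 hJ).1]
    have : m ∉ I := fun h => Finset.disjoint_right.1 hd hm.1 (hI h)
    simp [this]

/-- Here `n ∉ I` and `m ∉ J`, so neither ideal is the whole set. The pair of empty ideals vanishes,
and the other three combinations of empty and proper ideals are the three terms. The part `S \ I`
keeps `n`, so left factors are `↖` products. -/
theorem IsNw.prec_nw {n : γ} (h : IsNw q S T n) :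
    (ops K).prec ((ops K).nw (cls K q S) (cls K q T)) =
      ((ops K).nw (cls K q S)).rTensor _ ((ops K).prec (cls K q T))
        + ((ops K).nw.flip (cls K q T)).rTensor _ ((ops K).prec (cls K q S))
        + TensorProduct.map₂ (ops K).nw (ops K).mul ((ops K).prec (cls K q S))
          ((ops K).prec (cls K q T)) := by
  have hm := T.isGreatest_max' h.right
  set m := T.max' h.right
  rw [h.nw, h.prec_union hm, sum_ideals_notMem h.left.1,
    prec_cls' (h.isOrderOn.mono Finset.subset_union_left) h.left,
    prec_cls' (h.isOrderOn.mono Finset.subset_union_right) hm,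
    rTensor_sum_tmul, rTensor_sum_tmul, map₂_sum_tmul, add_assoc]
  congr 1
  · rw [sum_ideals_notMem hm.1, Finset.union_empty, cls_empty, TensorProduct.tmul_zero, zero_add]
    refine Finset.sum_congr rfl fun J hJ => ?_
    rw [Finset.sdiff_empty, Finset.empty_union, h.cls_union_sdiff (Finset.mem_filter.1 hJ).1]
  · rw [← Finset.sum_add_distrib]
    refine Finset.sum_congr rfl fun I hI => ?_
    obtain ⟨hI, hn⟩ := Finset.mem_filter.1 hI
    rw [sum_ideals_notMem hm.1, Finset.union_empty, Finset.sdiff_empty, h.cls_sdiff_union hn,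
      LinearMap.flip_apply]
    congr 1
    refine Finset.sum_congr rfl fun J hJ => ?_
    have hJ := (Finset.mem_filter.1 hJ).1
    rw [h.cls_sdiff_union_sdiff hn hJ, h.cls_union hI hn hJ]

/-- The ideals `I ∪ T` with `n ∈ I` leave `S \ I` on the left and give `x' ⊗ x'' ↖ y`. Among those
missing `n`, the case `J = T` yields `x ⊗ y` for `I = ∅` and `x' ⊗ x'' y` for proper `I`, the last
product being plain by `IsNw.isMul`. -/
theorem IsNw.succ_nw {n : γ} (h : IsNw q S T n) :
    (ops K).succ ((ops K).nw (cls K q S) (cls K q T)) =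
      cls K q S ⊗ₜ[K] cls K q T
        + ((ops K).nw (cls K q S)).rTensor _ ((ops K).succ (cls K q T))
        + ((ops K).nw.flip (cls K q T)).lTensor _ ((ops K).succ (cls K q S))
        + ((ops K).mul.flip (cls K q T)).lTensor _ ((ops K).prec (cls K q S))
        + TensorProduct.map₂ (ops K).nw (ops K).mul ((ops K).prec (cls K q S))
          ((ops K).succ (cls K q T)) := by
  have hm := T.isGreatest_max' h.right
  set m := T.max' h.right
  have hqS := h.isOrderOn.mono (S := S) Finset.subset_union_left
  rw [h.nw, h.succ_union hm, sum_ideals_notMem h.left.1, prec_cls' hqS h.left,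
    succ_cls' hqS h.left, succ_cls' (h.isOrderOn.mono Finset.subset_union_right) hm,
    rTensor_sum_tmul, lTensor_sum_tmul, lTensor_sum_tmul, map₂_sum_tmul]
  have e₁ : ∑ I ∈ ideals q S with n ∈ I, cls K q (S \ I) ⊗ₜ[K] cls K q (I ∪ T) =
      ∑ I ∈ properIdeals q S with n ∈ I,
        cls K q (S \ I) ⊗ₜ[K] (ops K).nw.flip (cls K q T) (cls K q I) := by
    rw [sum_ideals_mem h.left.1, Finset.sdiff_self, cls_empty, TensorProduct.zero_tmul, zero_add]
    refine Finset.sum_congr rfl fun I hI => ?_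
    obtain ⟨hI, hn⟩ := Finset.mem_filter.1 hI
    rw [h.cls_union_left hI hn, LinearMap.flip_apply]
  have e₂ : ∑ J ∈ ideals q T with m ∈ J, cls K q (S \ ∅ ∪ T \ J) ⊗ₜ[K] cls K q (∅ ∪ J) =
      cls K q S ⊗ₜ[K] cls K q T + ∑ J ∈ properIdeals q T with m ∈ J,
        (ops K).nw (cls K q S) (cls K q (T \ J)) ⊗ₜ[K] cls K q J := by
    rw [sum_ideals_mem hm.1, Finset.empty_union, Finset.sdiff_self, Finset.sdiff_empty,
      Finset.union_empty]
    congr 1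
    refine Finset.sum_congr rfl fun J hJ => ?_
    rw [Finset.empty_union, h.cls_union_sdiff (Finset.mem_filter.1 hJ).1]
  have e₃ : ∑ I ∈ properIdeals q S with n ∉ I, ∑ J ∈ ideals q T with m ∈ J,
      cls K q (S \ I ∪ T \ J) ⊗ₜ[K] cls K q (I ∪ J) =
      ∑ I ∈ properIdeals q S with n ∉ I,
        cls K q (S \ I) ⊗ₜ[K] (ops K).mul.flip (cls K q T) (cls K q I) +
        ∑ I ∈ properIdeals q S with n ∉ I, ∑ J ∈ properIdeals q T with m ∈ J,
          (ops K).nw (cls K q (S \ I)) (cls K q (T \ J)) ⊗ₜ[K]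
            (ops K).mul (cls K q I) (cls K q J) := by
    rw [← Finset.sum_add_distrib]
    refine Finset.sum_congr rfl fun I hI => ?_
    obtain ⟨hI, hn⟩ := Finset.mem_filter.1 hI
    rw [sum_ideals_mem hm.1, Finset.sdiff_self, Finset.union_empty, h.cls_union_left' hI hn,
      LinearMap.flip_apply]
    congr 1
    refine Finset.sum_congr rfl fun J hJ => ?_
    have hJ := (Finset.mem_filter.1 hJ).1
    rw [h.cls_sdiff_union_sdiff hn hJ, h.cls_union hI hn hJ]
  rw [e₁, e₂, e₃]
  abel

end compatibility

/-! ### Ambient totally ordered sets -/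

section glue

variable {α β : Type*} [LinearOrder α] [LinearOrder β]

/-- The relation on the ordered sum of `α` and `β` which extends `r` and `r'` and for which the
elements of `α` below those of `β` are the ones in `p`. -/
def glue (r : α → α → Prop) (r' : β → β → Prop) (p : α → Prop) (x y : α ⊕ₗ β) : Prop :=
  match ofLex x, ofLex y with
  | .inl x, .inl y => r x y
  | .inr x, .inr y => r' x y
  | .inl x, .inr _ => p x
  | .inr _, .inl _ => False

/-- Transitivity needs something new only for a chain of two elements of `α` followed by one of `β`;
`hp` is exactly this condition. -/
theorem isOrderOn_glue {r : α → α → Prop} {r' : β → β → Prop} {p : α → Prop} {S : Finset α}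
    {T : Finset β} (hr : IsOrderOn r S) (hr' : IsOrderOn r' T)
    (hp : ∀ x ∈ S, ∀ y ∈ S, r x y → p y → p x) :
    IsOrderOn (glue r r' p) (S.image Sum.inlₗ ∪ T.image Sum.inrₗ) where
  refl := by
    simp only [Finset.mem_union, Finset.mem_image]
    rintro _ (⟨x, hx, rfl⟩ | ⟨x, hx, rfl⟩)
    exacts [hr.refl x hx, hr'.refl x hx]
  antisymm := by
    simp only [Finset.mem_union, Finset.mem_image]
    rintro _ (⟨x, hx, rfl⟩ | ⟨x, hx, rfl⟩) _ (⟨y, hy, rfl⟩ | ⟨y, hy, rfl⟩) h h'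
    exacts [congrArg _ (hr.antisymm x hx y hy h h'), h'.elim, h.elim,
      congrArg _ (hr'.antisymm x hx y hy h h')]
  trans := by
    simp only [Finset.mem_union, Finset.mem_image]
    rintro _ (⟨x, hx, rfl⟩ | ⟨x, hx, rfl⟩) _ (⟨y, hy, rfl⟩ | ⟨y, hy, rfl⟩) _
      (⟨z, hz, rfl⟩ | ⟨z, hz, rfl⟩) h h'
    exacts [hr.trans x hx y hy z hz h h', hp x hx y hy h h', h'.elim, h, h.elim, h.elim,
      h'.elim, hr'.trans x hx y hy z hz h h']

theorem cls_glue_inl {r : α → α → Prop} {r' : β → β → Prop} {p : α → Prop} {S : Finset α}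
    (hr : IsOrderOn r S) : cls K (glue r r' p) (S.image Sum.inlₗ) = cls K r S :=
  cls_congr hr _ (fun _ _ _ _ h => Sum.Lex.inl_lt_inl_iff.2 h) fun _ _ _ _ => Iff.rfl

theorem cls_glue_inr {r : α → α → Prop} {r' : β → β → Prop} {p : α → Prop} {T : Finset β}
    (hr : IsOrderOn r' T) : cls K (glue r r' p) (T.image Sum.inrₗ) = cls K r' T :=
  cls_congr hr _ (fun _ _ _ _ h => Sum.Lex.inr_lt_inr_iff.2 h) fun _ _ _ _ => Iff.rfl

theorem isMul_glue {r : α → α → Prop} {r' : β → β → Prop} {S : Finset α} {T : Finset β}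
    (hr : IsOrderOn r S) (hr' : IsOrderOn r' T) (hS : S.Nonempty) (hT : T.Nonempty) :
    IsMul (glue r r' fun _ => False) (S.image Sum.inlₗ) (T.image Sum.inrₗ) where
  left := hS.image _
  right := hT.image _
  isOrderOn := isOrderOn_glue hr hr' fun _ _ _ _ _ h => h
  lt := by
    simp only [Finset.forall_mem_image]
    exact fun _ _ _ _ => Sum.Lex.inl_lt_inr _ _
  not_le := by
    simp only [Finset.forall_mem_image]
    exact fun _ _ _ _ h => h
  not_ge := by
    simp only [Finset.forall_mem_image]
    exact fun _ _ _ _ h => h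

theorem isNw_glue {r : α → α → Prop} {r' : β → β → Prop} {S : Finset α} {T : Finset β}
    (hr : IsOrderOn r S) (hr' : IsOrderOn r' T) {m : α} (hm : IsGreatest (S : Set α) m)
    (hT : T.Nonempty) :
    IsNw (glue r r' fun x => r x m) (S.image Sum.inlₗ) (T.image Sum.inrₗ) (Sum.inlₗ m) where
  left := by
    refine ⟨Finset.mem_coe.2 (Finset.mem_image_of_mem _ hm.1), ?_⟩
    rw [mem_upperBounds]
    simp only [Finset.mem_coe, Finset.forall_mem_image]
    exact fun x hx => Sum.Lex.inl_le_inl_iff.2 (hm.2 hx)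
  right := hT.image _
  isOrderOn := isOrderOn_glue hr hr' fun x hx y hy => hr.trans x hx y hy m hm.1
  lt := by
    simp only [Finset.forall_mem_image]
    exact fun _ _ _ _ => Sum.Lex.inl_lt_inr _ _
  le_iff := by
    simp only [Finset.forall_mem_image]
    exact fun _ _ _ _ => Iff.rfl
  not_ge := by
    simp only [Finset.forall_mem_image]
    exact fun _ _ _ _ h => h

end glue

end HSPPlus

namespace HSPPlus

variable {γ : Type*} [LinearOrder γ] {K : Type*} [Field K]

/-! ### The duplicial axioms -/

section duplicial

variable {q : γ → γ → Prop} {S T U : Finset γ}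

/-- Both sides are the class of `S ∪ T ∪ U`, once `S` and `T ∪ U` are seen to be unrelated as well.
-/
theorem IsMul.mul_assoc (h : IsMul q S T) (h' : IsMul q (S ∪ T) U) :
    (ops K).mul ((ops K).mul (cls K q S) (cls K q T)) (cls K q U) =
      (ops K).mul (cls K q S) ((ops K).mul (cls K q T) (cls K q U)) := by
  have h₁ : IsMul q T U := h'.mono Finset.subset_union_right subset_rfl h.right h'.right
  have h₂ : IsMul q S U := h'.mono Finset.subset_union_left subset_rfl h.left h'.right
  have h₃ : IsMul q S (T ∪ U) :=
    { left := h.left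
      right := h.right.mono Finset.subset_union_left
      isOrderOn := by rw [← Finset.union_assoc]; exact h'.isOrderOn
      lt := fun x hx y hy => (Finset.mem_union.1 hy).elim (h.lt x hx y) (h₂.lt x hx y)
      not_le := fun x hx y hy =>
        (Finset.mem_union.1 hy).elim (h.not_le x hx y) (h₂.not_le x hx y)
      not_ge := fun x hx y hy =>
        (Finset.mem_union.1 hy).elim (h.not_ge x hx y) (h₂.not_ge x hx y) }
  rw [h.mul, h'.mul, h₁.mul, h₃.mul, Finset.union_assoc]

theorem mem_right_of_isGreatest_union (hT : T.Nonempty) (hlt : ∀ x ∈ S, ∀ y ∈ T, x < y) {n : γ}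
    (hn : IsGreatest ((S ∪ T : Finset γ) : Set γ) n) : n ∈ T := by
  refine (Finset.mem_union.1 hn.1).resolve_left fun h => ?_
  obtain ⟨y, hy⟩ := hT
  exact (hlt n h y hy).not_ge (hn.2 (Finset.mem_union_right _ hy))

/-- The greatest element `n` of `S ∪ T` lies in `T`. Hence for `x ∈ S` and `y ∈ U`, being below `y`
means being below `n`, which in turn means being below `m`. -/
theorem IsNw.nw_assoc {m n : γ} (h : IsNw q S T m) (h' : IsNw q (S ∪ T) U n) :
    (ops K).nw ((ops K).nw (cls K q S) (cls K q T)) (cls K q U) =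
      (ops K).nw (cls K q S) ((ops K).nw (cls K q T) (cls K q U)) := by
  have hn : n ∈ T := mem_right_of_isGreatest_union h.right h.lt h'.left
  have h₁ : IsNw q T U n := h'.mono Finset.subset_union_right subset_rfl hn h'.right
  have h₃ : IsNw q S (T ∪ U) m :=
    { left := h.left
      right := h.right.mono Finset.subset_union_left
      isOrderOn := by rw [← Finset.union_assoc]; exact h'.isOrderOn
      lt := fun x hx y hy => (Finset.mem_union.1 hy).elim (h.lt x hx y)
        (h'.lt x (Finset.mem_union_left _ hx) y)
      le_iff := fun x hx y hy => (Finset.mem_union.1 hy).elim (h.le_iff x hx y) fun hy =>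
        (h'.le_iff x (Finset.mem_union_left _ hx) y hy).trans (h.le_iff x hx n hn)
      not_ge := fun x hx y hy => (Finset.mem_union.1 hy).elim (h.not_ge x hx y)
        (h'.not_ge x (Finset.mem_union_left _ hx) y) }
  rw [h.nw, h'.nw, h₁.nw, h₃.nw, Finset.union_assoc]

/-- Again `n ∈ T`; no element of `S` is below `n`, hence none is below an element of `U`. -/
theorem IsMul.mul_nw {n : γ} (h : IsMul q S T) (h' : IsNw q (S ∪ T) U n) :
    (ops K).nw ((ops K).mul (cls K q S) (cls K q T)) (cls K q U) =
      (ops K).mul (cls K q S) ((ops K).nw (cls K q T) (cls K q U)) := by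
  have hn : n ∈ T := mem_right_of_isGreatest_union h.right h.lt h'.left
  have h₁ : IsNw q T U n := h'.mono Finset.subset_union_right subset_rfl hn h'.right
  have h₃ : IsMul q S (T ∪ U) :=
    { left := h.left
      right := h.right.mono Finset.subset_union_left
      isOrderOn := by rw [← Finset.union_assoc]; exact h'.isOrderOn
      lt := fun x hx y hy => (Finset.mem_union.1 hy).elim (h.lt x hx y)
        (h'.lt x (Finset.mem_union_left _ hx) y)
      not_le := fun x hx y hy => (Finset.mem_union.1 hy).elim (h.not_le x hx y) fun hy hxy =>
        h.not_le x hx n hn ((h'.le_iff x (Finset.mem_union_left _ hx) y hy).1 hxy)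
      not_ge := fun x hx y hy => (Finset.mem_union.1 hy).elim (h.not_ge x hx y)
        (h'.not_ge x (Finset.mem_union_left _ hx) y) }
  rw [h.mul, h'.nw, h₁.nw, h₃.mul, Finset.union_assoc]

variable {δ : Type*} [LinearOrder δ] {r : δ → δ → Prop} {p : γ → Prop}

theorem isOrderOn_glue_inl (h : IsOrderOn q S) :
    IsOrderOn (glue q r p) (S.image Sum.inlₗ) where
  refl := by
    simp only [Finset.forall_mem_image]
    exact h.refl
  antisymm := by
    simp only [Finset.forall_mem_image]
    exact fun x hx y hy h₁ h₂ => congrArg _ (h.antisymm x hx y hy h₁ h₂)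
  trans := by
    simp only [Finset.forall_mem_image]
    exact h.trans

theorem IsMul.image_inl (h : IsMul q S T) :
    IsMul (glue q r p) (S.image Sum.inlₗ) (T.image Sum.inlₗ) where
  left := h.left.image _
  right := h.right.image _
  isOrderOn := by
    have h' := isOrderOn_glue_inl (r := r) (p := p) h.isOrderOn
    rw [Finset.image_union] at h'
    convert h'
  lt := by
    simp only [Finset.forall_mem_image]
    exact fun x hx y hy => Sum.Lex.inl_lt_inl_iff.2 (h.lt x hx y hy)
  not_le := by
    simp only [Finset.forall_mem_image]
    exact h.not_le
  not_ge := by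
    simp only [Finset.forall_mem_image]
    exact h.not_ge

theorem IsNw.image_inl {m : γ} (h : IsNw q S T m) :
    IsNw (glue q r p) (S.image Sum.inlₗ) (T.image Sum.inlₗ) (Sum.inlₗ m) where
  left := by
    refine ⟨Finset.mem_coe.2 (Finset.mem_image_of_mem _ h.left.1), ?_⟩
    rw [mem_upperBounds]
    simp only [Finset.mem_coe, Finset.forall_mem_image]
    exact fun x hx => Sum.Lex.inl_le_inl_iff.2 (h.left.2 hx)
  right := h.right.image _
  isOrderOn := by
    have h' := isOrderOn_glue_inl (r := r) (p := p) h.isOrderOn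
    rw [Finset.image_union] at h'
    convert h'
  lt := by
    simp only [Finset.forall_mem_image]
    exact fun x hx y hy => Sum.Lex.inl_lt_inl_iff.2 (h.lt x hx y hy)
  le_iff := by
    simp only [Finset.forall_mem_image]
    exact h.le_iff
  not_ge := by
    simp only [Finset.forall_mem_image]
    exact h.not_ge

end duplicial

/-- Every pair of special posets has a composition inside some totally ordered set. -/
theorem exists_isMul (P Q : SpecialPoset) :
    ∃ (q : Fin P.n ⊕ₗ Fin Q.n → Fin P.n ⊕ₗ Fin Q.n → Prop) (S T : Finset (Fin P.n ⊕ₗ Fin Q.n)),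
      IsMul q S T ∧ cls K q S = Finsupp.single P 1 ∧ cls K q T = Finsupp.single Q 1 :=
  ⟨_, _, _, isMul_glue (P.isOrderOn _) (Q.isOrderOn _) (represents_self P).nonempty
    (represents_self Q).nonempty, by rw [cls_glue_inl (P.isOrderOn _), cls_univ],
    by rw [cls_glue_inr (Q.isOrderOn _), cls_univ]⟩

theorem exists_isNw (P Q : SpecialPoset) :
    ∃ (q : Fin P.n ⊕ₗ Fin Q.n → Fin P.n ⊕ₗ Fin Q.n → Prop) (S T : Finset (Fin P.n ⊕ₗ Fin Q.n))
      (m : Fin P.n ⊕ₗ Fin Q.n),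
      IsNw q S T m ∧ cls K q S = Finsupp.single P 1 ∧ cls K q T = Finsupp.single Q 1 :=
  ⟨_, _, _, _, isNw_glue (P.isOrderOn _) (Q.isOrderOn _) (represents_self P).isGreatest
    (represents_self Q).nonempty, by rw [cls_glue_inl (P.isOrderOn _), cls_univ],
    by rw [cls_glue_inr (Q.isOrderOn _), cls_univ]⟩

/-- A third special poset can be glued to a composition by a composition. -/
theorem exists_isMul_union {q : γ → γ → Prop} {S : Finset γ} (hq : IsOrderOn q S)
    (hS : S.Nonempty) (R : SpecialPoset) : ∃ (q' : γ ⊕ₗ Fin R.n → γ ⊕ₗ Fin R.n → Prop)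
      (p : γ → Prop) (U : Finset (γ ⊕ₗ Fin R.n)), q' = glue q R.le p ∧
      IsMul q' (S.image Sum.inlₗ) U ∧ cls K q' U = Finsupp.single R 1 :=
  ⟨_, _, _, rfl, isMul_glue hq (R.isOrderOn _) hS (represents_self R).nonempty,
    by rw [cls_glue_inr (R.isOrderOn _), cls_univ]⟩

theorem exists_isNw_union {q : γ → γ → Prop} {S : Finset γ} (hq : IsOrderOn q S)
    (hS : S.Nonempty) (R : SpecialPoset) : ∃ (q' : γ ⊕ₗ Fin R.n → γ ⊕ₗ Fin R.n → Prop)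
      (p : γ → Prop) (U : Finset (γ ⊕ₗ Fin R.n)) (n : γ ⊕ₗ Fin R.n), q' = glue q R.le p ∧
      IsNw q' (S.image Sum.inlₗ) U n ∧ cls K q' U = Finsupp.single R 1 :=
  ⟨_, _, _, _, rfl, isNw_glue hq (R.isOrderOn _) (S.isGreatest_max' hS)
    (represents_self R).nonempty, by rw [cls_glue_inr (R.isOrderOn _), cls_univ]⟩

/-- `P` and `Q` are placed in one ambient order and `R` is appended to their union, so that a single
relation governs all three; the inclusion `Sum.inlₗ` changes no class. -/
theorem mul_assoc_single (P Q R : SpecialPoset) :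
    (ops K).mul ((ops K).mul (Finsupp.single P 1) (Finsupp.single Q 1)) (Finsupp.single R 1) =
      (ops K).mul (Finsupp.single P 1)
        ((ops K).mul (Finsupp.single Q 1) (Finsupp.single R 1)) := by
  obtain ⟨q, S, T, h, hS, hT⟩ := exists_isMul (K := K) P Q
  obtain ⟨q', p, U, rfl, h', hU⟩ := exists_isMul_union (K := K) h.isOrderOn
    (h.left.mono Finset.subset_union_left) R
  rw [Finset.image_union] at h'
  rw [← hS, ← hT, ← hU,
    ← cls_glue_inl (r' := R.le) (p := p) (h.isOrderOn.mono Finset.subset_union_left),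
    ← cls_glue_inl (r' := R.le) (p := p) (h.isOrderOn.mono Finset.subset_union_right)]
  exact h.image_inl.mul_assoc h'

theorem nw_assoc_single (P Q R : SpecialPoset) :
    (ops K).nw ((ops K).nw (Finsupp.single P 1) (Finsupp.single Q 1)) (Finsupp.single R 1) =
      (ops K).nw (Finsupp.single P 1)
        ((ops K).nw (Finsupp.single Q 1) (Finsupp.single R 1)) := by
  obtain ⟨q, S, T, m, h, hS, hT⟩ := exists_isNw (K := K) P Q
  obtain ⟨q', p, U, n, rfl, h', hU⟩ := exists_isNw_union (K := K) h.isOrderOn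
    (h.right.mono Finset.subset_union_right) R
  rw [Finset.image_union] at h'
  rw [← hS, ← hT, ← hU,
    ← cls_glue_inl (r' := R.le) (p := p) (h.isOrderOn.mono Finset.subset_union_left),
    ← cls_glue_inl (r' := R.le) (p := p) (h.isOrderOn.mono Finset.subset_union_right)]
  exact h.image_inl.nw_assoc h'

theorem mul_nw_single (P Q R : SpecialPoset) :
    (ops K).nw ((ops K).mul (Finsupp.single P 1) (Finsupp.single Q 1)) (Finsupp.single R 1) =
      (ops K).mul (Finsupp.single P 1)
        ((ops K).nw (Finsupp.single Q 1) (Finsupp.single R 1)) := by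
  obtain ⟨q, S, T, h, hS, hT⟩ := exists_isMul (K := K) P Q
  obtain ⟨q', p, U, n, rfl, h', hU⟩ := exists_isNw_union (K := K) h.isOrderOn
    (h.right.mono Finset.subset_union_right) R
  rw [Finset.image_union] at h'
  rw [← hS, ← hT, ← hU,
    ← cls_glue_inl (r' := R.le) (p := p) (h.isOrderOn.mono Finset.subset_union_left),
    ← cls_glue_inl (r' := R.le) (p := p) (h.isOrderOn.mono Finset.subset_union_right)]
  exact h.image_inl.mul_nw h'

theorem induction_single {C : HSPPlus K → Prop} (x : HSPPlus K)
    (single : ∀ P, C (Finsupp.single P 1)) (zero : C 0) (add : ∀ x y, C x → C y → C (x + y))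
    (smul : ∀ (a : K) x, C x → C (a • x)) : C x := by
  induction x using Finsupp.induction_linear with
  | zero => exact zero
  | add x y hx hy => exact add x y hx hy
  | single P a =>
    rw [← mul_one a, ← smul_eq_mul, ← Finsupp.smul_single]
    exact smul a _ (single P)

theorem isDuplicial : (ops K).IsDuplicial where
  mul_assoc x y z := by
    induction x using induction_single with
    | zero => simp
    | add x x' hx hx' => simp [hx, hx']
    | smul a x hx => simp [hx]
    | single P =>
    induction y using induction_single with
    | zero => simp
    | add x x' hx hx' => simp [hx, hx']
    | smul a x hx => simp [hx]
    | single Q =>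
    induction z using induction_single with
    | zero => simp
    | add x x' hx hx' => simp only [map_add, hx, hx']
    | smul a x hx => simp only [map_smul, hx]
    | single R => exact mul_assoc_single P Q R
  nw_assoc x y z := by
    induction x using induction_single with
    | zero => simp
    | add x x' hx hx' => simp [hx, hx']
    | smul a x hx => simp [hx]
    | single P =>
    induction y using induction_single with
    | zero => simp
    | add x x' hx hx' => simp [hx, hx']
    | smul a x hx => simp [hx]
    | single Q =>
    induction z using induction_single with
    | zero => simp
    | add x x' hx hx' => simp only [map_add, hx, hx']
    | smul a x hx => simp only [map_smul, hx]
    | single R => exact nw_assoc_single P Q R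
  mul_nw x y z := by
    induction x using induction_single with
    | zero => simp
    | add x x' hx hx' => simp [hx, hx']
    | smul a x hx => simp [hx]
    | single P =>
    induction y using induction_single with
    | zero => simp
    | add x x' hx hx' => simp [hx, hx']
    | smul a x hx => simp [hx]
    | single Q =>
    induction z using induction_single with
    | zero => simp
    | add x x' hx hx' => simp only [map_add, hx, hx']
    | smul a x hx => simp only [map_smul, hx]
    | single R => exact mul_nw_single P Q R

/-! ### The Dup-Dend bialgebra of special posets -/

theorem prec_mul (x y : HSPPlus K) : (ops K).prec ((ops K).mul x y) =
    y ⊗ₜ[K] x + ((ops K).mul x).lTensor _ ((ops K).prec y)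
      + ((ops K).mul x).rTensor _ ((ops K).prec y)
      + ((ops K).mul.flip y).rTensor _ ((ops K).red x)
      + TensorProduct.map₂ (ops K).mul (ops K).mul ((ops K).red x) ((ops K).prec y) := by
  induction x using induction_single with
  | zero => simp
  | add x x' hx hx' =>
    simp only [map_add, LinearMap.add_apply, LinearMap.lTensor_add, LinearMap.rTensor_add,
      TensorProduct.tmul_add, hx, hx']
    abel
  | smul a x hx =>
    simp only [map_smul, LinearMap.smul_apply, LinearMap.lTensor_smul, LinearMap.rTensor_smul,
      TensorProduct.tmul_smul, hx, smul_add]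
  | single P =>
  induction y using induction_single with
  | zero => simp
  | add x x' hx hx' =>
    simp only [map_add, LinearMap.add_apply, LinearMap.rTensor_add,
      TensorProduct.add_tmul, hx, hx']
    abel
  | smul a x hx =>
    simp only [map_smul, LinearMap.smul_apply, LinearMap.rTensor_smul,
      ← TensorProduct.smul_tmul', hx, smul_add]
  | single Q =>
    obtain ⟨q, S, T, h, hS, hT⟩ := exists_isMul (K := K) P Q
    rw [← hS, ← hT]
    exact h.prec_mul

theorem succ_mul (x y : HSPPlus K) : (ops K).succ ((ops K).mul x y) =
    x ⊗ₜ[K] y + ((ops K).mul x).rTensor _ ((ops K).succ y)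
      + ((ops K).mul x).lTensor _ ((ops K).succ y)
      + ((ops K).mul.flip y).lTensor _ ((ops K).red x)
      + TensorProduct.map₂ (ops K).mul (ops K).mul ((ops K).red x) ((ops K).succ y) := by
  induction x using induction_single with
  | zero => simp
  | add x x' hx hx' =>
    simp only [map_add, LinearMap.add_apply, LinearMap.lTensor_add, LinearMap.rTensor_add,
      TensorProduct.add_tmul, hx, hx']
    abel
  | smul a x hx =>
    simp only [map_smul, LinearMap.smul_apply, LinearMap.lTensor_smul, LinearMap.rTensor_smul,
      ← TensorProduct.smul_tmul', hx, smul_add]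
  | single P =>
  induction y using induction_single with
  | zero => simp
  | add x x' hx hx' =>
    simp only [map_add, LinearMap.add_apply, LinearMap.lTensor_add,
      TensorProduct.tmul_add, hx, hx']
    abel
  | smul a x hx =>
    simp only [map_smul, LinearMap.smul_apply, LinearMap.lTensor_smul,
      TensorProduct.tmul_smul, hx, smul_add]
  | single Q =>
    obtain ⟨q, S, T, h, hS, hT⟩ := exists_isMul (K := K) P Q
    rw [← hS, ← hT]
    exact h.succ_mul

theorem prec_nw (x y : HSPPlus K) : (ops K).prec ((ops K).nw x y) =
    ((ops K).nw x).rTensor _ ((ops K).prec y) + ((ops K).nw.flip y).rTensor _ ((ops K).prec x)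
      + TensorProduct.map₂ (ops K).nw (ops K).mul ((ops K).prec x) ((ops K).prec y) := by
  induction x using induction_single with
  | zero => simp
  | add x x' hx hx' =>
    simp only [map_add, LinearMap.add_apply, LinearMap.rTensor_add, hx, hx']
    abel
  | smul a x hx =>
    simp only [map_smul, LinearMap.smul_apply, LinearMap.rTensor_smul, hx, smul_add]
  | single P =>
  induction y using induction_single with
  | zero => simp
  | add x x' hx hx' =>
    simp only [map_add, LinearMap.add_apply, LinearMap.rTensor_add, hx, hx']
    abel
  | smul a x hx =>
    simp only [map_smul, LinearMap.smul_apply, LinearMap.rTensor_smul, hx, smul_add]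
  | single Q =>
    obtain ⟨q, S, T, m, h, hS, hT⟩ := exists_isNw (K := K) P Q
    rw [← hS, ← hT]
    exact h.prec_nw

theorem succ_nw (x y : HSPPlus K) : (ops K).succ ((ops K).nw x y) =
    x ⊗ₜ[K] y + ((ops K).nw x).rTensor _ ((ops K).succ y)
      + ((ops K).nw.flip y).lTensor _ ((ops K).succ x)
      + ((ops K).mul.flip y).lTensor _ ((ops K).prec x)
      + TensorProduct.map₂ (ops K).nw (ops K).mul ((ops K).prec x) ((ops K).succ y) := by
  induction x using induction_single with
  | zero => simp
  | add x x' hx hx' =>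
    simp only [map_add, LinearMap.add_apply, LinearMap.rTensor_add,
      TensorProduct.add_tmul, hx, hx']
    abel
  | smul a x hx =>
    simp only [map_smul, LinearMap.smul_apply, LinearMap.rTensor_smul,
      ← TensorProduct.smul_tmul', hx, smul_add]
  | single P =>
  induction y using induction_single with
  | zero => simp
  | add x x' hx hx' =>
    simp only [map_add, LinearMap.add_apply, LinearMap.lTensor_add,
      TensorProduct.tmul_add, hx, hx']
    abel
  | smul a x hx =>
    simp only [map_smul, LinearMap.smul_apply, LinearMap.lTensor_smul,
      TensorProduct.tmul_smul, hx, smul_add]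
  | single Q =>
    obtain ⟨q, S, T, m, h, hS, hT⟩ := exists_isNw (K := K) P Q
    rw [← hS, ← hT]
    exact h.succ_nw

theorem isBialgebra : (ops K).IsBialgebra where
  duplicial := isDuplicial
  dendriform := isDendriform
  prec_mul := prec_mul
  succ_mul := succ_mul
  prec_nw := prec_nw
  succ_nw := succ_nw

end HSPPlus

/-! ### Transfer of the axioms along a surjective morphism -/

namespace DupDendOps

variable {K A B : Type*} [Field K] [AddCommGroup A] [Module K A] [AddCommGroup B] [Module K B]

namespace IsMorphism

variable {D : DupDendOps K A} {E : DupDendOps K B} {f : A →ₗ[K] B}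

theorem map_red (h : D.IsMorphism E f) (x : A) :
    TensorProduct.map f f (D.red x) = E.red (f x) := by
  simp only [red, LinearMap.add_apply, map_add, h.map_prec, h.map_succ]

theorem rTensor_map {φ : A →ₗ[K] A ⊗[K] A} {ψ : B →ₗ[K] B ⊗[K] B}
    (h : ∀ x, TensorProduct.map f f (φ x) = ψ (f x)) (t : A ⊗[K] A) :
    TensorProduct.assoc K B B B (ψ.rTensor B (TensorProduct.map f f t)) =
      TensorProduct.map f (TensorProduct.map f f)
        (TensorProduct.assoc K A A A (φ.rTensor A t)) := by
  induction t with
  | zero => simp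
  | add x y hx hy => simp only [map_add, hx, hy]
  | tmul x y =>
    rw [TensorProduct.map_tmul, LinearMap.rTensor_tmul, LinearMap.rTensor_tmul, ← h]
    -- The associator computes only on pure tensors, so `φ x` has to be decomposed in its turn.
    induction φ x with
    | zero => simp
    | add x y hx hy => simp only [map_add, TensorProduct.add_tmul, hx, hy]
    | tmul x y => simp

theorem lTensor_map {φ : A →ₗ[K] A ⊗[K] A} {ψ : B →ₗ[K] B ⊗[K] B}
    (h : ∀ x, TensorProduct.map f f (φ x) = ψ (f x)) (t : A ⊗[K] A) :
    ψ.lTensor B (TensorProduct.map f f t) =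
      TensorProduct.map f (TensorProduct.map f f) (φ.lTensor A t) := by
  induction t with
  | zero => simp
  | add x y hx hy => simp only [map_add, hx, hy]
  | tmul x y => simp [h]

theorem rTensor_map_left {φ : A →ₗ[K] A} {ψ : B →ₗ[K] B} (h : ∀ x, f (φ x) = ψ (f x))
    (t : A ⊗[K] A) :
    ψ.rTensor B (TensorProduct.map f f t) = TensorProduct.map f f (φ.rTensor A t) := by
  induction t with
  | zero => simp
  | add x y hx hy => simp only [map_add, hx, hy]
  | tmul x y => simp [h]

theorem lTensor_map_right {φ : A →ₗ[K] A} {ψ : B →ₗ[K] B} (h : ∀ x, f (φ x) = ψ (f x))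
    (t : A ⊗[K] A) :
    ψ.lTensor B (TensorProduct.map f f t) = TensorProduct.map f f (φ.lTensor A t) := by
  induction t with
  | zero => simp
  | add x y hx hy => simp only [map_add, hx, hy]
  | tmul x y => simp [h]

theorem map₂_map {φ φ' : A →ₗ[K] A →ₗ[K] A} {ψ ψ' : B →ₗ[K] B →ₗ[K] B}
    (h : ∀ x y, f (φ x y) = ψ (f x) (f y)) (h' : ∀ x y, f (φ' x y) = ψ' (f x) (f y))
    (t u : A ⊗[K] A) :
    TensorProduct.map₂ ψ ψ' (TensorProduct.map f f t) (TensorProduct.map f f u) =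
      TensorProduct.map f f (TensorProduct.map₂ φ φ' t u) := by
  induction t with
  | zero => simp
  | add x y hx hy => simp only [map_add, LinearMap.add_apply, hx, hy]
  | tmul x y =>
    induction u with
    | zero => simp
    | add x y hx hy => simp only [map_add, hx, hy]
    | tmul x' y' => simp [h, h']

/-- The axioms of a Dup-Dend bialgebra are inherited by the image of a morphism. -/
theorem isBialgebra_of_surjective (h : D.IsMorphism E f) (hf : Function.Surjective f)
    (hD : D.IsBialgebra) : E.IsBialgebra where
  duplicial :=
    { mul_assoc := hf.forall₃.2 fun x y z => by
        simp only [← h.map_mul, hD.duplicial.mul_assoc]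
      nw_assoc := hf.forall₃.2 fun x y z => by
        simp only [← h.map_nw, hD.duplicial.nw_assoc]
      mul_nw := hf.forall₃.2 fun x y z => by
        simp only [← h.map_mul, ← h.map_nw, hD.duplicial.mul_nw] }
  dendriform :=
    { prec_prec := hf.forall.2 fun x => by
        rw [← h.map_prec, rTensor_map h.map_prec, lTensor_map h.map_red,
          hD.dendriform.prec_prec]
      succ_prec := hf.forall.2 fun x => by
        rw [← h.map_prec, ← h.map_succ, rTensor_map h.map_succ, lTensor_map h.map_prec,
          hD.dendriform.succ_prec]
      red_succ := hf.forall.2 fun x => by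
        rw [← h.map_succ, rTensor_map h.map_red, lTensor_map h.map_succ,
          hD.dendriform.red_succ] }
  prec_mul := hf.forall₂.2 fun x y => by
    rw [← h.map_mul, ← h.map_prec, ← h.map_prec, ← h.map_red, lTensor_map_right (h.map_mul x),
      rTensor_map_left (h.map_mul x), rTensor_map_left (φ := D.mul.flip y) fun z => h.map_mul z y,
      map₂_map h.map_mul h.map_mul, hD.prec_mul]
    simp only [map_add, TensorProduct.map_tmul]
  succ_mul := hf.forall₂.2 fun x y => by
    rw [← h.map_mul, ← h.map_succ, ← h.map_succ, ← h.map_red, lTensor_map_right (h.map_mul x),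
      rTensor_map_left (h.map_mul x), lTensor_map_right (φ := D.mul.flip y) fun z => h.map_mul z y,
      map₂_map h.map_mul h.map_mul, hD.succ_mul]
    simp only [map_add, TensorProduct.map_tmul]
  prec_nw := hf.forall₂.2 fun x y => by
    rw [← h.map_nw, ← h.map_prec, ← h.map_prec, ← h.map_prec,
      rTensor_map_left (h.map_nw x), rTensor_map_left (φ := D.nw.flip y) fun z => h.map_nw z y,
      map₂_map h.map_nw h.map_mul, hD.prec_nw]
    simp only [map_add]
  succ_nw := hf.forall₂.2 fun x y => by
    rw [← h.map_nw, ← h.map_succ, ← h.map_succ, ← h.map_succ, ← h.map_prec,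
      rTensor_map_left (h.map_nw x), lTensor_map_right (φ := D.nw.flip y) fun z => h.map_nw z y,
      lTensor_map_right (φ := D.mul.flip y) fun z => h.map_mul z y,
      map₂_map h.map_nw h.map_mul, hD.succ_nw]
    simp only [map_add, TensorProduct.map_tmul]

end IsMorphism

end DupDendOps

/-! ### Permutations as orders -/

/-- The hypothesis makes `ρ⁻¹ ∘ σ` increasing, and the identity is the only increasing bijection of
`Fin n`. One implication suffices because the orders are total. -/
theorem perm_eq_of_le_iff {n : ℕ} {σ ρ : Equiv.Perm (Fin n)}
    (h : ∀ i j, σ.symm i ≤ σ.symm j → ρ.symm i ≤ ρ.symm j) : σ = ρ := by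
  have hm : StrictMono (σ.trans ρ.symm) := by
    refine Monotone.strictMono_of_injective (fun i j hij => ?_) (Equiv.injective _)
    simpa using h (σ i) (σ j) (by simpa using hij)
  let e : Fin n ≃o Fin n := hm.orderIsoOfSurjective _ (Equiv.surjective _)
  have he : e = OrderIso.refl _ := Subsingleton.elim _ _
  ext i : 1
  have := DFunLike.congr_fun he i
  change ρ.symm (σ i) = i at this
  rw [← this, Equiv.apply_symm_apply, this]

theorem exists_perm_le_iff_of_injective {n : ℕ} {γ : Type*} [LinearOrder γ] {f : Fin n → γ}
    (hf : Function.Injective f) :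
    ∃ σ : Equiv.Perm (Fin n), ∀ i j, σ.symm i ≤ σ.symm j ↔ f i ≤ f j := by
  have hm : StrictMono (f ∘ Tuple.sort f) :=
    (Tuple.monotone_sort f).strictMono_of_injective (hf.comp (Equiv.injective _))
  refine ⟨Tuple.sort f, fun i j => ?_⟩
  rw [← hm.le_iff_le]
  simp

theorem exists_perm_le_iff {n : ℕ} {r : Fin n → Fin n → Prop} (hr : IsOrderOn r Finset.univ)
    (ht : ∀ i j, r i j ∨ r j i) :
    ∃ σ : Equiv.Perm (Fin n), ∀ i j, σ.symm i ≤ σ.symm j ↔ r i j := by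
  classical
  -- Counting predecessors embeds the total order `r` into `ℕ`, which reduces to the previous lemma.
  let f : Fin n → ℕ := fun i => (Finset.univ.filter fun k => r k i).card
  have h₁ : ∀ i j, r i j → f i ≤ f j := fun i j hij => Finset.card_le_card fun k => by
    simp only [Finset.mem_filter, Finset.mem_univ, true_and]
    exact fun hk => hr.trans k (by simp) i (by simp) j (by simp) hk hij
  have h₂ : ∀ i j, ¬ r i j → f j < f i := fun i j hij => by
    refine Finset.card_lt_card (Finset.ssubset_iff_subset_ne.2 ⟨fun k => ?_, fun he => hij ?_⟩)
    · simp only [Finset.mem_filter, Finset.mem_univ, true_and]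
      exact fun hk => hr.trans k (by simp) j (by simp) i (by simp) hk ((ht i j).resolve_left hij)
    · have : i ∈ Finset.univ.filter fun k => r k i := by simpa using hr.refl i (by simp)
      rw [← he] at this
      simpa using this
  have h₃ : ∀ i j, f i ≤ f j ↔ r i j := fun i j =>
    ⟨fun h => by_contra fun h' => (h₂ i j h').not_ge h, h₁ i j⟩
  obtain ⟨σ, hσ⟩ := exists_perm_le_iff_of_injective (f := f) fun i j hij =>
    hr.antisymm i (by simp) j (by simp) ((h₃ i j).1 hij.le) ((h₃ j i).1 hij.ge)
  exact ⟨σ, fun i j => (hσ i j).trans (h₃ i j)⟩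

namespace PermWord

/-- The letter `i` stands at the position of the letter `j`, or before, in the word of `σ`. -/
def posLE (σ : PermWord) (i j : Fin σ.n) : Prop := σ.perm.symm i ≤ σ.perm.symm j

/-- The greatest letter. -/
def maxLetter (σ : PermWord) : Fin σ.n := ⟨σ.n - 1, Nat.sub_lt σ.pos Nat.one_pos⟩

/-- The special poset whose only linear extension is `σ`: its elements are totally ordered by
their positions in the word of `σ`. -/
def toPoset (σ : PermWord) : SpecialPoset where
  n := σ.n
  pos := σ.pos
  le := σ.posLE
  refl _ := le_refl (σ.perm.symm _)
  antisymm _ _ h h' := σ.perm.symm.injective (le_antisymm h h')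
  trans _ _ _ h h' := le_trans (α := Fin σ.n) h h'

end PermWord

/-! ### Linear extensions of total orders and surjectivity of `Θ` -/

section theta

variable {K : Type*} [Field K]

open Classical in
theorem thetaPlus_single (P : SpecialPoset) : thetaPlus K (Finsupp.single P 1) =
    ∑ σ : Equiv.Perm (Fin P.n) with P.IsLinearExtension σ,
      Finsupp.single (PermWord.mk P.n P.pos σ) (1 : K) := by
  simp [thetaPlus]

open Classical in
-- When `≤₁` is total, a linear extension must list the elements exactly in this order, so there is
-- only one.
theorem thetaPlus_of_le_iff {P : SpecialPoset} {σ : Equiv.Perm (Fin P.n)}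
    (h : ∀ i j, P.le i j ↔ σ.symm i ≤ σ.symm j) :
    thetaPlus K (Finsupp.single P 1) = Finsupp.single (PermWord.mk P.n P.pos σ) 1 := by
  rw [thetaPlus_single]
  refine Finset.sum_eq_single_of_mem σ ?_ ?_
  · refine Finset.mem_filter.2 ⟨Finset.mem_univ _, fun i j hij hne => ?_⟩
    exact lt_of_le_of_ne ((h i j).1 hij) fun h => hne (σ.symm.injective h)
  · intro ρ hρ hne
    refine absurd (perm_eq_of_le_iff fun i j hij => ?_).symm hne
    obtain rfl | hne := eq_or_ne i j
    · exact le_rfl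
    · exact ((Finset.mem_filter.1 hρ).2 i j ((h i j).2 hij) hne).le

theorem thetaPlus_toPoset (σ : PermWord) :
    thetaPlus K (Finsupp.single σ.toPoset 1) = Finsupp.single σ 1 :=
  thetaPlus_of_le_iff (P := σ.toPoset) (σ := σ.perm) fun _ _ => Iff.rfl

theorem thetaPlus_surjective : Function.Surjective (thetaPlus K) := by
  intro y
  induction y using Finsupp.induction_linear with
  | zero => exact ⟨0, map_zero _⟩
  | add x y hx hy =>
    obtain ⟨a, rfl⟩ := hx
    obtain ⟨b, rfl⟩ := hy
    exact ⟨a + b, map_add _ _ _⟩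
  | single σ a =>
    refine ⟨a • Finsupp.single σ.toPoset 1, ?_⟩
    rw [map_smul, thetaPlus_toPoset, Finsupp.smul_single, smul_eq_mul, mul_one]

end theta

/-! ### Shuffles -/

namespace PermWord

/-- The permutation `(σ ⊗ τ) ∘ ε`. -/
def shufflePerm {k l : ℕ} (σ : Equiv.Perm (Fin k)) (τ : Equiv.Perm (Fin l))
    (ε : Equiv.Perm (Fin (k + l))) : Equiv.Perm (Fin (k + l)) :=
  ε.trans (finSumFinEquiv.permCongr (Equiv.sumCongr σ τ))

variable {k l : ℕ} (σ : Equiv.Perm (Fin k)) (τ : Equiv.Perm (Fin l))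
  (ε : Equiv.Perm (Fin (k + l)))

theorem shufflePerm_symm_castAdd (i : Fin k) :
    (shufflePerm σ τ ε).symm (Fin.castAdd l i) = ε.symm (Fin.castAdd l (σ.symm i)) := by
  rw [Equiv.symm_apply_eq]
  simp [shufflePerm, Equiv.permCongr_apply]

theorem shufflePerm_symm_natAdd (j : Fin l) :
    (shufflePerm σ τ ε).symm (Fin.natAdd k j) = ε.symm (Fin.natAdd k (τ.symm j)) := by
  rw [Equiv.symm_apply_eq]
  simp [shufflePerm, Equiv.permCongr_apply]

open Classical in
-- A word on `k + l` letters amounts to its subword of small letters, its subword of large letters,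
-- and the positions they occupy. These are recorded by `σ`, `τ` and the shuffle `ε`.
theorem sum_perm_eq_sum_shuffle {M : Type*} [AddCommMonoid M]
    (F : Equiv.Perm (Fin (k + l)) → M) :
    ∑ ω, F ω = ∑ σ : Equiv.Perm (Fin k), ∑ τ : Equiv.Perm (Fin l),
      ∑ ε : Equiv.Perm (Fin (k + l)) with IsShuffle k l ε, F (shufflePerm σ τ ε) := by
  simp only [Finset.sum_sigma']
  symm
  refine Finset.sum_bij (fun x _ => shufflePerm x.1 x.2.1 x.2.2) ?_ ?_ ?_ fun _ _ => rfl
  · simp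
  · rintro ⟨σ, τ, ε⟩ h ⟨σ', τ', ε'⟩ h' he
    simp only [Finset.mem_sigma, Finset.mem_univ, Finset.mem_filter, true_and] at h h' he
    -- Since `ε⁻¹` is increasing on the first block, the relative positions of the small letters in
    -- the shuffled word are those in `σ`; thus `σ` is recovered from the word.
    obtain rfl : σ = σ' := perm_eq_of_le_iff fun i j hij => by
      have h₁ := h.1.monotone hij
      simp only [← shufflePerm_symm_castAdd σ τ ε, he] at h₁
      exact h'.1.le_iff_le.1 (by simpa only [shufflePerm_symm_castAdd] using h₁)
    obtain rfl : τ = τ' := perm_eq_of_le_iff fun i j hij => by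
      have h₁ := h.2.monotone hij
      simp only [← shufflePerm_symm_natAdd σ τ ε, he] at h₁
      exact h'.2.le_iff_le.1 (by simpa only [shufflePerm_symm_natAdd] using h₁)
    obtain rfl : ε = ε' := by
      ext i : 1
      exact (finSumFinEquiv.permCongr (Equiv.sumCongr σ τ)).injective (DFunLike.congr_fun he i)
    rfl
  · intro ω _
    -- `σ` and `τ` standardize the subwords of small and of large letters of `ω`; the shuffle is
    -- what remains after removing them.
    obtain ⟨σ, hσ⟩ := exists_perm_le_iff_of_injective
      (f := fun i : Fin k => ω.symm (Fin.castAdd l i))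
      (ω.symm.injective.comp (Fin.castAdd_injective k l))
    obtain ⟨τ, hτ⟩ := exists_perm_le_iff_of_injective
      (f := fun j : Fin l => ω.symm (Fin.natAdd k j))
      (ω.symm.injective.comp (Fin.natAdd_injective l k))
    refine ⟨⟨σ, τ, ω.trans (finSumFinEquiv.permCongr (Equiv.sumCongr σ τ)).symm⟩, ?_, ?_⟩
    · simp only [Finset.mem_sigma, Finset.mem_univ, Finset.mem_filter, true_and]
      constructor
      · refine strictMono_of_le_iff_le fun i j => ?_
        have := hσ (σ i) (σ j)
        simpa [Equiv.permCongr] using this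
      · refine strictMono_of_le_iff_le fun i j => ?_
        have := hτ (τ i) (τ j)
        simpa [Equiv.permCongr] using this
    · ext i : 1
      simp [shufflePerm]

end PermWord

/-! ### `Θ` and the products -/

section products

variable {K : Type*} [Field K]

/-- The special poset on `Fin (P.n + Q.n)` which corresponds to `HSPPlus.glue P.le Q.le p`. -/
def SpecialPoset.glue (P Q : SpecialPoset) (p : Fin P.n → Prop)
    (hp : ∀ x y, P.le x y → p y → p x) : SpecialPoset where
  n := P.n + Q.n
  pos := Nat.add_pos_left P.pos _
  le x y := HSPPlus.glue P.le Q.le p (toLex (finSumFinEquiv.symm x))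
    (toLex (finSumFinEquiv.symm y))
  refl x := by
    rcases finSumFinEquiv.symm x with x | x
    exacts [P.refl x, Q.refl x]
  antisymm x y h h' := by
    rw [← finSumFinEquiv.symm.injective.eq_iff]
    revert h h'
    rcases finSumFinEquiv.symm x with x | x <;> rcases finSumFinEquiv.symm y with y | y <;>
      intro h h'
    exacts [congrArg _ (P.antisymm x y h h'), h'.elim, h.elim, congrArg _ (Q.antisymm x y h h')]
  trans x y z h h' := by
    revert h h'
    rcases finSumFinEquiv.symm x with x | x <;> rcases finSumFinEquiv.symm y with y | y <;>
      rcases finSumFinEquiv.symm z with z | z <;> intro h h'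
    exacts [P.trans x y z h h', hp x y h h', h'.elim, h, h.elim, h.elim, h'.elim,
      Q.trans x y z h h']

theorem strictMono_finSumFinEquiv_symm (k l : ℕ) :
    StrictMono fun x : Fin (k + l) => (toLex (finSumFinEquiv.symm x) : Fin k ⊕ₗ Fin l) := by
  intro x y hxy
  obtain ⟨x, rfl⟩ := finSumFinEquiv.surjective x
  obtain ⟨y, rfl⟩ := finSumFinEquiv.surjective y
  simp only [Equiv.symm_apply_apply]
  rcases x with x | x <;> rcases y with y | y
  · exact Sum.Lex.inl_lt_inl_iff.2 hxy
  · exact Sum.Lex.inl_lt_inr _ _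
  · simp only [finSumFinEquiv_apply_left, finSumFinEquiv_apply_right, Fin.lt_def,
      Fin.val_castAdd, Fin.val_natAdd] at hxy
    omega
  · simp only [finSumFinEquiv_apply_right, Fin.lt_def, Fin.val_natAdd] at hxy
    exact Sum.Lex.inr_lt_inr_iff.2 (Fin.lt_def.2 (by omega))

theorem HSPPlus.represents_glue (P Q : SpecialPoset) (p : Fin P.n → Prop)
    (hp : ∀ x y, P.le x y → p y → p x) :
    Represents (P.glue Q p hp) (glue P.le Q.le p)
      (Finset.univ.image Sum.inlₗ ∪ Finset.univ.image Sum.inrₗ)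
      (fun x : Fin (P.n + Q.n) => toLex (finSumFinEquiv.symm x)) where
  strictMono := strictMono_finSumFinEquiv_symm P.n Q.n
  image_eq := by
    ext x
    refine iff_of_true (Finset.mem_image.2
      ⟨(finSumFinEquiv (ofLex x) : Fin (P.n + Q.n)), Finset.mem_univ _, ?_⟩) ?_
    · exact congrArg toLex (finSumFinEquiv.symm_apply_apply (ofLex x))
    · rw [Finset.mem_union, Finset.mem_image, Finset.mem_image]
      rcases x with x | x
      · exact Or.inl ⟨x, Finset.mem_univ _, rfl⟩
      · exact Or.inr ⟨x, Finset.mem_univ _, rfl⟩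
  le_iff _ _ := Iff.rfl

theorem SpecialPoset.isLinearExtension_glue {P Q : SpecialPoset} {p : Fin P.n → Prop}
    {hp : ∀ x y, P.le x y → p y → p x} {ω : Equiv.Perm (Fin (P.n + Q.n))} :
    (P.glue Q p hp).IsLinearExtension ω ↔
      (∀ i j, P.le i j → i ≠ j → ω.symm (Fin.castAdd Q.n i) < ω.symm (Fin.castAdd Q.n j)) ∧
      (∀ i j, Q.le i j → i ≠ j → ω.symm (Fin.natAdd P.n i) < ω.symm (Fin.natAdd P.n j)) ∧
      ∀ i j, p i → ω.symm (Fin.castAdd Q.n i) < ω.symm (Fin.natAdd P.n j) := by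
  have key : (P.glue Q p hp).IsLinearExtension ω ↔ ∀ x y : Fin P.n ⊕ Fin Q.n,
      HSPPlus.glue P.le Q.le p (toLex x) (toLex y) → x ≠ y →
        ω.symm (finSumFinEquiv x) < ω.symm (finSumFinEquiv y) := by
    constructor
    · intro h x y hxy hne
      refine h (finSumFinEquiv x) (finSumFinEquiv y) ?_ (finSumFinEquiv.injective.ne hne)
      change HSPPlus.glue P.le Q.le p (toLex (finSumFinEquiv.symm (finSumFinEquiv x)))
        (toLex (finSumFinEquiv.symm (finSumFinEquiv y)))
      rwa [Equiv.symm_apply_apply, Equiv.symm_apply_apply]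
    · intro h (x : Fin (P.n + Q.n)) (y : Fin (P.n + Q.n)) hxy hne
      have := h _ _ hxy (finSumFinEquiv.symm.injective.ne hne)
      rwa [Equiv.apply_symm_apply, Equiv.apply_symm_apply] at this
  rw [key]
  constructor
  · intro h
    exact ⟨fun i j hij hne => h (.inl i) (.inl j) hij (Sum.inl_injective.ne hne),
      fun i j hij hne => h (.inr i) (.inr j) hij (Sum.inr_injective.ne hne),
      fun i j hi => h (.inl i) (.inr j) hi Sum.inl_ne_inr⟩
  · rintro ⟨h₁, h₂, h₃⟩ (i | i) (j | j) hij hne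
    · exact h₁ i j hij fun h => hne (congrArg _ h)
    · exact h₃ i j hij
    · exact hij.elim
    · exact h₂ i j hij fun h => hne (congrArg _ h)

/-- Replaces the abstract enumeration of the lexicographic sum by the explicit one on `Fin (P.n +
Q.n)`, the index set of the shuffles. -/
theorem HSPPlus.mul_single_eq_glue (P Q : SpecialPoset) :
    (ops K).mul (Finsupp.single P 1) (Finsupp.single Q 1) =
      Finsupp.single (P.glue Q (fun _ => False) fun _ _ _ h => h) 1 := by
  have h := (isMul_glue (P.isOrderOn _) (Q.isOrderOn _) (represents_self P).nonempty
    (represents_self Q).nonempty).mul (K := K)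
  rw [cls_glue_inl (P.isOrderOn _), cls_glue_inr (Q.isOrderOn _), cls_univ, cls_univ] at h
  rw [h, ← (represents_glue P Q _ _).cls_eq]
  congr!

theorem HSPPlus.nw_single_eq_glue (P Q : SpecialPoset) :
    (ops K).nw (Finsupp.single P 1) (Finsupp.single Q 1) =
      Finsupp.single (P.glue Q (fun x => P.le x P.top) fun x y => P.trans x y P.top) 1 := by
  have h := (isNw_glue (m := P.top) (P.isOrderOn _) (Q.isOrderOn _)
    (represents_self P).isGreatest (represents_self Q).nonempty).nw (K := K)
  rw [cls_glue_inl (P.isOrderOn _), cls_glue_inr (Q.isOrderOn _), cls_univ, cls_univ] at h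
  rw [h, ← (represents_glue P Q _ _).cls_eq]
  congr!

/-- A shuffle preserves the relative positions of the letters of the first word, so it creates no
new constraint among them. -/
theorem PermWord.IsShuffle.forall_castAdd_iff {P : SpecialPoset} {l : ℕ}
    {σ : Equiv.Perm (Fin P.n)} {τ : Equiv.Perm (Fin l)} {ε : Equiv.Perm (Fin (P.n + l))}
    (h : IsShuffle P.n l ε) :
    (∀ i j, P.le i j → i ≠ j → (shufflePerm σ τ ε).symm (Fin.castAdd l i) <
      (shufflePerm σ τ ε).symm (Fin.castAdd l j)) ↔ P.IsLinearExtension σ := by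
  simp only [shufflePerm_symm_castAdd, SpecialPoset.IsLinearExtension]
  exact forall₄_congr fun i j _ _ => h.1.lt_iff_lt

theorem PermWord.IsShuffle.forall_natAdd_iff {Q : SpecialPoset} {k : ℕ}
    {σ : Equiv.Perm (Fin k)} {τ : Equiv.Perm (Fin Q.n)} {ε : Equiv.Perm (Fin (k + Q.n))}
    (h : IsShuffle k Q.n ε) :
    (∀ i j, Q.le i j → i ≠ j → (shufflePerm σ τ ε).symm (Fin.natAdd k i) <
      (shufflePerm σ τ ε).symm (Fin.natAdd k j)) ↔ Q.IsLinearExtension τ := by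
  simp only [shufflePerm_symm_natAdd, SpecialPoset.IsLinearExtension]
  exact forall₄_congr fun i j _ _ => h.2.lt_iff_lt

open Classical in
-- Common to both products: `C` is void for the shuffle product, and for `↖` it is the condition on
-- the greatest letter of `σ`.
theorem sum_filter_shuffle {P Q : SpecialPoset} {M : Type*} [AddCommMonoid M]
    (D : Equiv.Perm (Fin (P.n + Q.n)) → Prop) (C : Equiv.Perm (Fin P.n) →
      Equiv.Perm (Fin (P.n + Q.n)) → Prop) (F : Equiv.Perm (Fin (P.n + Q.n)) → M)
    (hD : ∀ σ τ ε, PermWord.IsShuffle P.n Q.n ε → (D (PermWord.shufflePerm σ τ ε) ↔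
      P.IsLinearExtension σ ∧ Q.IsLinearExtension τ ∧ C σ ε)) :
    ∑ ω with D ω, F ω = ∑ σ with P.IsLinearExtension σ, ∑ τ with Q.IsLinearExtension τ,
      ∑ ε with PermWord.IsShuffle P.n Q.n ε ∧ C σ ε, F (PermWord.shufflePerm σ τ ε) := by
  rw [Finset.sum_filter, PermWord.sum_perm_eq_sum_shuffle, Finset.sum_filter]
  refine Finset.sum_congr rfl fun σ _ => ?_
  rw [Finset.sum_filter]
  split_ifs with hσ
  · refine Finset.sum_congr rfl fun τ _ => ?_
    rw [← Finset.filter_filter, Finset.sum_filter (p := C σ)]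
    split_ifs with hτ
    · refine Finset.sum_congr rfl fun ε hε => ?_
      simp only [hD σ τ ε (Finset.mem_filter.1 hε).2, hσ, hτ, true_and]
    · refine Finset.sum_eq_zero fun ε hε => if_neg ?_
      simp only [hD σ τ ε (Finset.mem_filter.1 hε).2, hτ, false_and, and_false, not_false_eq_true]
  · refine Finset.sum_eq_zero fun τ _ => Finset.sum_eq_zero fun ε hε => if_neg ?_
    simp only [hD σ τ ε (Finset.mem_filter.1 hε).2, hσ, false_and, not_false_eq_true]

open Classical in
theorem FQSymPlus.mul_single (σ τ : PermWord) :
    (ops K).mul (Finsupp.single σ 1) (Finsupp.single τ 1) =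
      ∑ ε : Equiv.Perm (Fin (σ.n + τ.n)) with PermWord.IsShuffle σ.n τ.n ε,
        Finsupp.single (σ.shuffled τ ε) (1 : K) := by
  simp [ops]

open Classical in
theorem FQSymPlus.nw_single (σ τ : PermWord) :
    (ops K).nw (Finsupp.single σ 1) (Finsupp.single τ 1) =
      ∑ ε : Equiv.Perm (Fin (σ.n + τ.n)) with PermWord.IsShuffle σ.n τ.n ε ∧
          ε.symm (Fin.castAdd τ.n σ.posMax) ≤ ε.symm (Fin.natAdd σ.n ⟨0, τ.pos⟩),
        Finsupp.single (σ.shuffled τ ε) (1 : K) := by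
  simp [ops]

open Classical in
theorem thetaPlus_mul_single (P Q : SpecialPoset) :
    thetaPlus K ((HSPPlus.ops K).mul (Finsupp.single P 1) (Finsupp.single Q 1)) =
      (FQSymPlus.ops K).mul (thetaPlus K (Finsupp.single P 1))
        (thetaPlus K (Finsupp.single Q 1)) := by
  rw [HSPPlus.mul_single_eq_glue, thetaPlus_single, thetaPlus_single P, thetaPlus_single Q,
    map_sum (FQSymPlus.ops K).mul, LinearMap.sum_apply]
  simp only [map_sum, FQSymPlus.mul_single]
  have h := sum_filter_shuffle (P := P) (Q := Q)
    (P.glue Q (fun _ => False) fun _ _ _ h => h).IsLinearExtension (fun _ _ => True)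
    (fun ω => Finsupp.single (PermWord.mk (P.n + Q.n) (Nat.add_pos_left P.pos _) ω) (1 : K))
    fun σ τ ε hε => by
      rw [SpecialPoset.isLinearExtension_glue, hε.forall_castAdd_iff, hε.forall_natAdd_iff]
      simp
  refine h.trans (Finset.sum_congr rfl fun σ _ => Finset.sum_congr rfl fun τ _ =>
    Finset.sum_congr (Finset.ext fun ε => ?_) fun _ _ => rfl)
  simp only [Finset.mem_filter, and_true]

open Classical in
theorem thetaPlus_nw_single (P Q : SpecialPoset) :
    thetaPlus K ((HSPPlus.ops K).nw (Finsupp.single P 1) (Finsupp.single Q 1)) =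
      (FQSymPlus.ops K).nw (thetaPlus K (Finsupp.single P 1))
        (thetaPlus K (Finsupp.single Q 1)) := by
  rw [HSPPlus.nw_single_eq_glue, thetaPlus_single, thetaPlus_single P, thetaPlus_single Q,
    map_sum (FQSymPlus.ops K).nw, LinearMap.sum_apply]
  simp only [map_sum, FQSymPlus.nw_single]
  have h := sum_filter_shuffle (P := P) (Q := Q)
    (P.glue Q (fun x => P.le x P.top) fun x y => P.trans x y P.top).IsLinearExtension
    (fun σ ε => ε.symm (Fin.castAdd Q.n (σ.symm P.top)) ≤ ε.symm (Fin.natAdd P.n ⟨0, Q.pos⟩))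
    (fun ω => Finsupp.single (PermWord.mk (P.n + Q.n) (Nat.add_pos_left P.pos _) ω) (1 : K))
    fun σ τ ε hε => by
      rw [SpecialPoset.isLinearExtension_glue, hε.forall_castAdd_iff, hε.forall_natAdd_iff]
      refine and_congr_right fun hσ => and_congr_right fun hτ => ?_
      simp only [PermWord.shufflePerm_symm_castAdd, PermWord.shufflePerm_symm_natAdd]
      constructor
      · intro h
        -- The extreme pair: `g_P` and the first letter of the word of `τ`.
        simpa using (h P.top (τ ⟨0, Q.pos⟩) (P.refl _)).le
      · intro h i j hi
        have h₁ : ε.symm (Fin.castAdd Q.n (σ.symm i)) ≤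
            ε.symm (Fin.castAdd Q.n (σ.symm P.top)) := by
          obtain rfl | hne := eq_or_ne i P.top
          · exact le_rfl
          · exact hε.1.monotone (hσ i P.top hi hne).le
        have h₂ : ε.symm (Fin.natAdd P.n ⟨0, Q.pos⟩) ≤ ε.symm (Fin.natAdd P.n (τ.symm j)) :=
          hε.2.monotone (Fin.le_def.2 (Nat.zero_le _))
        refine lt_of_le_of_ne (h₁.trans (h.trans h₂)) fun he => ?_
        have := ε.symm.injective he
        simp only [Fin.ext_iff, Fin.val_castAdd, Fin.val_natAdd] at this
        omega
  refine h.trans (Finset.sum_congr rfl fun σ _ => Finset.sum_congr rfl fun τ _ =>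
    Finset.sum_congr (Finset.ext fun ε => ?_) fun _ _ => rfl)
  simp only [Finset.mem_filter]
  rfl

end products

/-! ### `Θ` and the coproducts -/

section coproducts

open HSPPlus

variable {K : Type*} [Field K] {γ : Type*} [LinearOrder γ] [Fintype γ]

open Classical in
/-- The total orders on the finite set `S` which extend the relation `q`. -/
noncomputable def linearOrdersOn (q : γ → γ → Prop) (S : Finset γ) : Finset (γ → γ → Prop) :=
  Finset.univ.filter fun s => (∀ x y, s x y → x ∈ S ∧ y ∈ S) ∧ IsOrderOn s S ∧
    (∀ x ∈ S, ∀ y ∈ S, s x y ∨ s y x) ∧ ∀ x ∈ S, ∀ y ∈ S, q x y → s x y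

theorem mem_linearOrdersOn {q s : γ → γ → Prop} {S : Finset γ} :
    s ∈ linearOrdersOn q S ↔ (∀ x y, s x y → x ∈ S ∧ y ∈ S) ∧ IsOrderOn s S ∧
      (∀ x ∈ S, ∀ y ∈ S, s x y ∨ s y x) ∧ ∀ x ∈ S, ∀ y ∈ S, q x y → s x y := by
  simp [linearOrdersOn]

open Classical in
-- Linear extensions are encoded by total orders on `S` rather than by permutations, so that passing
-- to a subset needs no renumbering. Each order `s` contributes a single permutation. The support
-- condition in `linearOrdersOn` makes `s` determined by its values on `S`.
theorem thetaPlus_cls {q : γ → γ → Prop} {S : Finset γ} (hS : S.Nonempty) (hq : IsOrderOn q S) :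
    thetaPlus K (cls K q S) = ∑ s ∈ linearOrdersOn q S, thetaPlus K (cls K s S) := by
  obtain ⟨P, f, h⟩ := exists_represents hS hq
  let φ : Equiv.Perm (Fin P.n) → γ → γ → Prop :=
    fun σ x y => ∃ i j, f i = x ∧ f j = y ∧ σ.symm i ≤ σ.symm j
  have hφ : ∀ σ i j, φ σ (f i) (f j) ↔ σ.symm i ≤ σ.symm j := fun σ i j => by
    constructor
    · rintro ⟨i', j', hi, hj, hij⟩
      rwa [← h.strictMono.injective hi, ← h.strictMono.injective hj]
    · exact fun hij => ⟨i, j, rfl, rfl, hij⟩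
  have hr : ∀ σ, Represents (PermWord.mk P.n P.pos σ).toPoset (φ σ) S f := fun σ =>
    ⟨h.strictMono, h.image_eq, fun i j => (hφ σ i j).symm⟩
  rw [h.cls_eq, thetaPlus_single]
  refine Finset.sum_bij (fun σ _ => φ σ) ?_ ?_ ?_ ?_
  · intro σ hσ
    refine mem_linearOrdersOn.2 ⟨?_, (hr σ).isOrderOn, ?_, ?_⟩
    · rintro _ _ ⟨i, j, rfl, rfl, -⟩
      exact ⟨h.mem i, h.mem j⟩
    · intro x hx y hy
      obtain ⟨i, rfl⟩ := h.exists_eq hx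
      obtain ⟨j, rfl⟩ := h.exists_eq hy
      rw [hφ, hφ]
      exact le_total _ _
    · intro x hx y hy hxy
      obtain ⟨i, rfl⟩ := h.exists_eq hx
      obtain ⟨j, rfl⟩ := h.exists_eq hy
      rw [hφ]
      obtain rfl | hne := eq_or_ne i j
      · exact le_rfl
      · exact ((Finset.mem_filter.1 hσ).2 i j ((h.le_iff i j).2 hxy) hne).le
  · intro σ _ τ _ hστ
    refine perm_eq_of_le_iff fun i j hij => ?_
    rw [← hφ] at hij ⊢
    rwa [← hστ]
  · intro s hs
    obtain ⟨hsS, hso, hst, hsq⟩ := mem_linearOrdersOn.1 hs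
    obtain ⟨σ, hσ⟩ := exists_perm_le_iff (r := fun i j => s (f i) (f j))
      { refl := fun i _ => hso.refl _ (h.mem i)
        antisymm := fun i _ j _ h₁ h₂ =>
          h.strictMono.injective (hso.antisymm _ (h.mem i) _ (h.mem j) h₁ h₂)
        trans := fun i _ j _ k _ => hso.trans _ (h.mem i) _ (h.mem j) _ (h.mem k) }
      fun i j => hst _ (h.mem i) _ (h.mem j)
    refine ⟨σ, Finset.mem_filter.2 ⟨Finset.mem_univ _, fun i j hij hne => ?_⟩, ?_⟩
    · refine lt_of_le_of_ne ((hσ i j).2 (hsq _ (h.mem i) _ (h.mem j) ((h.le_iff i j).1 hij)))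
        fun he => hne (σ.symm.injective he)
    · funext x y
      refine propext ⟨?_, fun hxy => ?_⟩
      · rintro ⟨i, j, rfl, rfl, hij⟩
        exact (hσ i j).1 hij
      · obtain ⟨i, rfl⟩ := h.exists_eq (hsS x y hxy).1
        obtain ⟨j, rfl⟩ := h.exists_eq (hsS _ y hxy).2
        exact (hφ σ i j).2 ((hσ i j).2 hxy)
  · intro σ _
    rw [(hr σ).cls_eq, thetaPlus_toPoset]

/-! #### Cuts of a word -/

/-- A standardized subword is the only linear extension of the set of its letters, ordered by
position. In this way cuts of words are expressed through subsets of a poset. -/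
theorem thetaPlus_subword (σ : PermWord) (s : Finset (Fin σ.n)) (hs : s.Nonempty) :
    Finsupp.single (σ.subword s hs) (1 : K) =
      thetaPlus K (cls K σ.posLE (s.image σ.perm)) := by
  have : Nonempty {i // i ∈ s} := hs.to_subtype
  let e : {i // i ∈ s} ≃ {x // σ.perm.symm x ∈ s} := σ.perm.subtypeEquiv fun i => by simp
  let u := Fintype.orderIsoFinOfCardEq {i // i ∈ s} rfl
  let v := Fintype.orderIsoFinOfCardEq {x // σ.perm.symm x ∈ s} (Fintype.card_congr e).symm
  have h : Represents (σ.subword s hs).toPoset σ.posLE (s.image σ.perm)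
      (fun k => (v k : Fin σ.n)) :=
    { strictMono := fun i j hij => v.strictMono hij
      image_eq := by
        ext x
        refine Finset.mem_image.trans (Iff.trans ?_ Finset.mem_image.symm)
        constructor
        · rintro ⟨k, -, rfl⟩
          exact ⟨σ.perm.symm (v k), (v k).2, σ.perm.apply_symm_apply _⟩
        · rintro ⟨i, hi, rfl⟩
          exact ⟨v.symm ⟨σ.perm i, by simpa using hi⟩, Finset.mem_univ _,
            congrArg Subtype.val (v.apply_symm_apply _)⟩
      le_iff := fun i j => by
        change u.symm (e.symm (v i)) ≤ u.symm (e.symm (v j)) ↔ _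
        rw [u.symm.le_iff_le]
        rfl }
  rw [h.cls_eq, thetaPlus_toPoset]

/-- The ideals of a total order are its final segments. Those starting at some `k` are nonempty, and
`0 < k` excludes the whole set. -/
theorem sum_properIdeals_posLE {M : Type*} [AddCommMonoid M] (σ : PermWord)
    (F : Finset (Fin σ.n) → M) :
    ∑ I ∈ properIdeals σ.posLE Finset.univ, F I =
      ∑ k : Fin σ.n with 0 < k.val, F ((Finset.Ici k).image σ.perm) := by
  symm
  refine Finset.sum_bij (fun k _ => (Finset.Ici k).image σ.perm) ?_ ?_ ?_ fun _ _ => rfl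
  · intro k hk
    rw [Finset.mem_filter] at hk
    rw [mem_properIdeals, mem_ideals]
    refine ⟨⟨Finset.subset_univ _, ?_⟩, ?_, ?_⟩
    · intro x hx y _ hxy
      obtain ⟨i, hi, rfl⟩ := Finset.mem_image.1 hx
      refine Finset.mem_image.2 ⟨σ.perm.symm y, ?_, by simp⟩
      rw [Finset.mem_Ici] at hi ⊢
      rw [PermWord.posLE, Equiv.symm_apply_apply] at hxy
      exact hi.trans hxy
    · exact ⟨_, Finset.mem_image_of_mem _ (Finset.mem_Ici.2 le_rfl)⟩
    · refine ⟨σ.perm ⟨0, σ.pos⟩, Finset.mem_sdiff.2 ⟨Finset.mem_univ _, fun h => ?_⟩⟩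
      obtain ⟨i, hi, he⟩ := Finset.mem_image.1 h
      obtain rfl := σ.perm.injective he
      exact absurd (Fin.le_def.1 (Finset.mem_Ici.1 hi)) (not_le.2 hk.2)
  · intro k _ l _ h
    have h := Finset.image_injective σ.perm.injective h
    refine le_antisymm ?_ ?_
    · exact Finset.mem_Ici.1 (h ▸ Finset.mem_Ici.2 le_rfl)
    · exact Finset.mem_Ici.1 (h ▸ Finset.mem_Ici.2 le_rfl)
  · intro I hI
    rw [mem_properIdeals, mem_ideals] at hI
    obtain ⟨⟨-, hI⟩, hI', x, hx⟩ := hI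
    have hne : (I.image σ.perm.symm).Nonempty := hI'.image _
    -- The cut is made at the first position holding a letter of `I`.
    set k := (I.image σ.perm.symm).min' hne with hk
    have hIk : I = (Finset.Ici k).image σ.perm := by
      ext y
      rw [Finset.mem_image]
      constructor
      · intro hy
        refine ⟨σ.perm.symm y, Finset.mem_Ici.2 ?_, by simp⟩
        exact Finset.min'_le _ _ (Finset.mem_image_of_mem _ hy)
      · rintro ⟨i, hi, rfl⟩
        obtain ⟨z, hz, hzk⟩ := Finset.mem_image.1 (Finset.min'_mem _ hne)
        refine hI z hz _ (Finset.mem_univ _) ?_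
        change σ.perm.symm z ≤ σ.perm.symm (σ.perm i)
        rw [hzk, Equiv.symm_apply_apply]
        exact Finset.mem_Ici.1 hi
    refine ⟨k, Finset.mem_filter.2 ⟨Finset.mem_univ _, Nat.pos_of_ne_zero fun h0 => ?_⟩, hIk.symm⟩
    refine (Finset.mem_sdiff.1 hx).2 ?_
    rw [hIk]
    refine Finset.mem_image.2 ⟨σ.perm.symm x, Finset.mem_Ici.2 (Fin.le_def.2 ?_), by simp⟩
    omega

theorem PermWord.maxLetter_mem_image_Ici (σ : PermWord) (k : Fin σ.n) :
    σ.maxLetter ∈ (Finset.Ici k).image σ.perm ↔ k ≤ σ.posMax := by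
  rw [Finset.mem_image]
  constructor
  · rintro ⟨i, hi, he⟩
    have : σ.posMax = i := σ.perm.symm_apply_eq.2 he.symm
    rw [this]
    exact Finset.mem_Ici.1 hi
  · exact fun h => ⟨σ.posMax, Finset.mem_Ici.2 h, σ.perm.apply_symm_apply _⟩

theorem PermWord.univ_sdiff_image_Ici (σ : PermWord) (k : Fin σ.n) :
    Finset.univ \ (Finset.Ici k).image σ.perm = (Finset.Iio k).image σ.perm := by
  ext x
  obtain ⟨i, rfl⟩ := σ.perm.surjective x
  simp

theorem thetaPlus_left (σ : PermWord) (k : Fin σ.n) (hk : 0 < k.val) :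
    Finsupp.single (σ.left k hk) (1 : K) =
      thetaPlus K (cls K σ.posLE (Finset.univ \ (Finset.Ici k).image σ.perm)) := by
  rw [σ.univ_sdiff_image_Ici]
  exact thetaPlus_subword σ _ _

theorem thetaPlus_right (σ : PermWord) (k : Fin σ.n) :
    Finsupp.single (σ.right k) (1 : K) =
      thetaPlus K (cls K σ.posLE ((Finset.Ici k).image σ.perm)) :=
  thetaPlus_subword σ _ _

theorem FQSymPlus.prec_single (σ : PermWord) : (ops K).prec (Finsupp.single σ 1) =
    ∑ I ∈ properIdeals σ.posLE Finset.univ with σ.maxLetter ∉ I,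
      thetaPlus K (cls K σ.posLE (Finset.univ \ I)) ⊗ₜ[K] thetaPlus K (cls K σ.posLE I) := by
  rw [Finset.sum_filter, sum_properIdeals_posLE, ← Finset.sum_filter, Finset.filter_filter]
  simp only [ops, Finsupp.linearCombination_single, one_smul, thetaPlus_left, thetaPlus_right,
    σ.maxLetter_mem_image_Ici, not_le]
  rw [← Finset.sum_subtype (Finset.univ.filter fun k : Fin σ.n => 0 < k.val ∧ σ.posMax < k)
    (fun k => ?_) (fun k => thetaPlus K (cls K σ.posLE (Finset.univ \ (Finset.Ici k).image σ.perm))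
      ⊗ₜ[K] thetaPlus K (cls K σ.posLE ((Finset.Ici k).image σ.perm)))]
  -- A cut to the right of the greatest letter is automatically at a positive position.
  simp only [Finset.mem_filter, Finset.mem_univ, true_and, and_iff_right_iff_imp]
  exact fun h => (Nat.zero_le _).trans_lt h

theorem FQSymPlus.succ_single (σ : PermWord) : (ops K).succ (Finsupp.single σ 1) =
    ∑ I ∈ properIdeals σ.posLE Finset.univ with σ.maxLetter ∈ I,
      thetaPlus K (cls K σ.posLE (Finset.univ \ I)) ⊗ₜ[K] thetaPlus K (cls K σ.posLE I) := by
  rw [Finset.sum_filter, sum_properIdeals_posLE, ← Finset.sum_filter, Finset.filter_filter]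
  simp only [ops, Finsupp.linearCombination_single, one_smul, thetaPlus_left, thetaPlus_right,
    σ.maxLetter_mem_image_Ici]
  rw [← Finset.sum_subtype (Finset.univ.filter fun k : Fin σ.n => 0 < k.val ∧ k ≤ σ.posMax)
    (fun k => ?_) (fun k => thetaPlus K (cls K σ.posLE (Finset.univ \ (Finset.Ici k).image σ.perm))
      ⊗ₜ[K] thetaPlus K (cls K σ.posLE ((Finset.Ici k).image σ.perm)))]
  simp only [Finset.mem_filter, Finset.mem_univ, true_and]

/-! #### Cuts of linear extensions -/

/-- The restriction of the relation `s` to the finite set `S`. -/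
def restrictRel {δ : Type*} (s : δ → δ → Prop) (S : Finset δ) (x y : δ) : Prop := x ∈ S ∧ y ∈ S ∧ s x y

theorem restrictRel_mem {q s : γ → γ → Prop} {S T : Finset γ} (hs : s ∈ linearOrdersOn q T)
    (h : S ⊆ T) : restrictRel s S ∈ linearOrdersOn q S := by
  obtain ⟨-, h₁, h₂, h₃⟩ := mem_linearOrdersOn.1 hs
  refine mem_linearOrdersOn.2 ⟨fun x y hxy => ⟨hxy.1, hxy.2.1⟩, ⟨?_, ?_, ?_⟩, ?_, ?_⟩
  · exact fun x hx => ⟨hx, hx, h₁.refl x (h hx)⟩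
  · exact fun x hx y hy hxy hyx => h₁.antisymm x (h hx) y (h hy) hxy.2.2 hyx.2.2
  · exact fun x hx y hy z hz hxy hyz =>
      ⟨hx, hz, h₁.trans x (h hx) y (h hy) z (h hz) hxy.2.2 hyz.2.2⟩
  · exact fun x hx y hy => (h₂ x (h hx) y (h hy)).imp (fun h => ⟨hx, hy, h⟩) fun h => ⟨hy, hx, h⟩
  · exact fun x hx y hy hxy => ⟨hx, hy, h₃ x (h hx) y (h hy) hxy⟩

/-- The ordinal sum of two relations, the first one on the complement of `I` and the second one
on `I`. -/
def ordinalSum (I : Finset γ) (s t : γ → γ → Prop) (x y : γ) : Prop :=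
  s x y ∨ t x y ∨ x ∉ I ∧ y ∈ I

variable {q : γ → γ → Prop} {I : Finset γ}

/-- Placing the complement of `I` entirely before `I` respects `q`, because no element of the ideal
`I` is below an element outside it. -/
theorem ordinalSum_mem (hI : I ∈ ideals q Finset.univ) {s t : γ → γ → Prop}
    (hs : s ∈ linearOrdersOn q (Finset.univ \ I)) (ht : t ∈ linearOrdersOn q I) :
    ordinalSum I s t ∈ linearOrdersOn q Finset.univ ∧
      I ∈ ideals (ordinalSum I s t) Finset.univ := by
  rw [mem_ideals] at hI
  rw [mem_linearOrdersOn] at hs ht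
  simp only [Finset.mem_sdiff, Finset.mem_univ, true_and] at hs
  obtain ⟨hs₁, ⟨hs₂, hs₃, hs₄⟩, hs₅, hs₆⟩ := hs
  obtain ⟨ht₁, ⟨ht₂, ht₃, ht₄⟩, ht₅, ht₆⟩ := ht
  simp only [Finset.mem_sdiff, Finset.mem_univ, true_and] at hs₂ hs₃ hs₄
  rw [mem_linearOrdersOn, mem_ideals]
  refine ⟨⟨by simp, ⟨?_, ?_, ?_⟩, ?_, ?_⟩, Finset.subset_univ I, ?_⟩ <;>
    simp only [ordinalSum, Finset.mem_univ, true_imp_iff]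
  · intro x
    by_cases hx : x ∈ I
    exacts [.inr (.inl (ht₂ x hx)), .inl (hs₂ x hx)]
  · grind
  · grind
  · grind
  · grind
  · grind

/-- If `I` is an ideal of a total order `s`, then `s` puts the complement before `I`, so `s` is the
ordinal sum of its two restrictions. -/
theorem sum_linearOrdersOn_cut (hI : I ∈ ideals q Finset.univ) {M : Type*} [AddCommMonoid M]
    [DecidablePred fun s : γ → γ → Prop => I ∈ ideals s Finset.univ]
    (F : (γ → γ → Prop) → (γ → γ → Prop) → M) :
    ∑ s ∈ linearOrdersOn q Finset.univ with I ∈ ideals s Finset.univ,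
      F (restrictRel s (Finset.univ \ I)) (restrictRel s I) =
    ∑ s ∈ linearOrdersOn q (Finset.univ \ I), ∑ t ∈ linearOrdersOn q I, F s t := by
  rw [← Finset.sum_product']
  refine Finset.sum_nbij' (fun s => (restrictRel s (Finset.univ \ I), restrictRel s I))
    (fun p => ordinalSum I p.1 p.2) ?_ ?_ ?_ ?_ fun _ _ => rfl
  · intro s hs
    have hs := (Finset.mem_filter.1 hs).1
    exact Finset.mem_product.2 ⟨restrictRel_mem hs (Finset.subset_univ _),
      restrictRel_mem hs (Finset.subset_univ _)⟩
  · intro p hp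
    obtain ⟨h₁, h₂⟩ := Finset.mem_product.1 hp
    exact Finset.mem_filter.2 (ordinalSum_mem hI h₁ h₂)
  · intro s hs
    obtain ⟨hs, hI'⟩ := Finset.mem_filter.1 hs
    obtain ⟨-, -, h₁, -⟩ := mem_linearOrdersOn.1 hs
    have h₂ := (mem_ideals.1 hI').2
    funext x y
    have h₁ := h₁ x (Finset.mem_univ x) y (Finset.mem_univ y)
    have h₃ := fun hx => h₂ x hx y (Finset.mem_univ y)
    have h₄ := fun hy => h₂ y hy x (Finset.mem_univ x)
    simp only [ordinalSum, restrictRel, Finset.mem_sdiff, Finset.mem_univ, true_and, eq_iff_iff]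
    tauto
  · rintro ⟨s, t⟩ hp
    obtain ⟨h₁, h₂⟩ := Finset.mem_product.1 hp
    have hs := (mem_linearOrdersOn.1 h₁).1
    have ht := (mem_linearOrdersOn.1 h₂).1
    simp only [Finset.mem_sdiff, Finset.mem_univ, true_and] at hs
    refine Prod.ext ?_ ?_ <;> funext x y <;> have hs := hs x y <;> have ht := ht x y <;>
      simp only [ordinalSum, restrictRel, Finset.mem_sdiff, Finset.mem_univ, true_and, eq_iff_iff]
    · tauto
    · tauto

theorem cls_restrictRel {δ : Type*} [LinearOrder δ] {s : δ → δ → Prop} {S : Finset δ} (hs : IsOrderOn s S) :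
    cls K (restrictRel s S) S = cls K s S :=
  cls_congr_rel hs fun _ hx _ hy => ⟨fun h => ⟨hx, hy, h⟩, fun h => h.2.2⟩

/-- Cutting the linear extensions of a poset, or extending linearly the two parts of a cut. -/
theorem sum_cut_linearOrdersOn (hq : IsOrderOn q Finset.univ) (p : Finset γ → Prop)
    [DecidablePred p] :
    ∑ I ∈ properIdeals q Finset.univ with p I,
      thetaPlus K (cls K q (Finset.univ \ I)) ⊗ₜ[K] thetaPlus K (cls K q I) =
    ∑ s ∈ linearOrdersOn q Finset.univ, ∑ I ∈ properIdeals s Finset.univ with p I,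
      thetaPlus K (cls K s (Finset.univ \ I)) ⊗ₜ[K] thetaPlus K (cls K s I) := by
  classical
  -- As `s` extends `q`, every ideal of `s` is one of `q`; the summations can be exchanged, with `I`
  -- outermost.
  rw [Finset.sum_comm' (t' := (properIdeals q Finset.univ).filter p)
    (s' := fun I => (linearOrdersOn q Finset.univ).filter fun s => I ∈ ideals s Finset.univ)]
  · refine Finset.sum_congr rfl fun I hI => ?_
    obtain ⟨hI, h₁, h₂⟩ := mem_properIdeals.1 (Finset.mem_filter.1 hI).1
    rw [thetaPlus_cls h₁ (hq.mono (Finset.subset_univ _)),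
      thetaPlus_cls h₂ (hq.mono (Finset.subset_univ _)), TensorProduct.sum_tmul]
    simp only [TensorProduct.tmul_sum]
    rw [← sum_linearOrdersOn_cut hI fun s t =>
      thetaPlus K (cls K s (Finset.univ \ I)) ⊗ₜ[K] thetaPlus K (cls K t I)]
    refine Finset.sum_congr rfl fun s hs => ?_
    have hs := (mem_linearOrdersOn.1 (Finset.mem_filter.1 hs).1).2.1
    rw [cls_restrictRel (hs.mono (Finset.subset_univ _)),
      cls_restrictRel (hs.mono (Finset.subset_univ _))]
  · intro s I
    simp only [Finset.mem_filter, mem_properIdeals, mem_ideals, mem_linearOrdersOn]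
    constructor
    · rintro ⟨hs, ⟨hI, h₁, h₂⟩, hp⟩
      exact ⟨⟨hs, hI⟩, ⟨⟨hI.1, fun x hx y hy hxy => hI.2 x hx y hy
        (hs.2.2.2 x (Finset.mem_univ x) y hy hxy)⟩, h₁, h₂⟩, hp⟩
    · rintro ⟨⟨hs, hI⟩, ⟨-, h₁, h₂⟩, hp⟩
      exact ⟨hs, ⟨hI, h₁, h₂⟩, hp⟩

theorem exists_eq_posLE {P : SpecialPoset} {s : Fin P.n → Fin P.n → Prop}
    (hs : s ∈ linearOrdersOn P.le Finset.univ) :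
    ∃ σ : Equiv.Perm (Fin P.n), s = (PermWord.mk P.n P.pos σ).posLE := by
  obtain ⟨-, h₁, h₂, -⟩ := mem_linearOrdersOn.1 hs
  obtain ⟨σ, hσ⟩ := exists_perm_le_iff h₁ fun i j => h₂ i (Finset.mem_univ i) j (Finset.mem_univ j)
  exact ⟨σ, funext fun i => funext fun j => propext (hσ i j).symm⟩

theorem thetaPlus_cls_posLE (σ : PermWord) :
    thetaPlus K (cls K σ.posLE Finset.univ) = Finsupp.single σ 1 := by
  rw [← thetaPlus_toPoset, ← cls_univ]
  rfl

/-- Letters are numbered by `≤₂`, so `g_P` is the greatest letter of every linear extension. The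
condition defining `Δ_≺` is therefore the same on both sides, and `sum_cut_linearOrdersOn` applies.
-/
theorem thetaPlus_prec_single (P : SpecialPoset) :
    TensorProduct.map (thetaPlus K) (thetaPlus K)
      ((HSPPlus.ops K).prec (Finsupp.single P 1)) =
      (FQSymPlus.ops K).prec (thetaPlus K (Finsupp.single P 1)) := by
  rw [← cls_univ, prec_cls' (m := P.top) (P.isOrderOn _) (represents_self P).isGreatest, map_sum]
  simp only [TensorProduct.map_tmul]
  rw [thetaPlus_cls (represents_self P).nonempty (P.isOrderOn _), map_sum]
  rw [sum_cut_linearOrdersOn (P.isOrderOn _) fun I => P.top ∉ I]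
  refine Finset.sum_congr rfl fun s hs => ?_
  obtain ⟨σ, rfl⟩ := exists_eq_posLE hs
  rw [thetaPlus_cls_posLE, FQSymPlus.prec_single]
  rfl

theorem thetaPlus_succ_single (P : SpecialPoset) :
    TensorProduct.map (thetaPlus K) (thetaPlus K)
      ((HSPPlus.ops K).succ (Finsupp.single P 1)) =
      (FQSymPlus.ops K).succ (thetaPlus K (Finsupp.single P 1)) := by
  rw [← cls_univ, succ_cls' (m := P.top) (P.isOrderOn _) (represents_self P).isGreatest, map_sum]
  simp only [TensorProduct.map_tmul]
  rw [thetaPlus_cls (represents_self P).nonempty (P.isOrderOn _), map_sum]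
  rw [sum_cut_linearOrdersOn (P.isOrderOn _) fun I => P.top ∈ I]
  refine Finset.sum_congr rfl fun s hs => ?_
  obtain ⟨σ, rfl⟩ := exists_eq_posLE hs
  rw [thetaPlus_cls_posLE, FQSymPlus.succ_single]
  rfl

end coproducts

/-! ### The morphism `Θ` and the conclusion -/

theorem isMorphism_thetaPlus (K : Type*) [Field K] :
    (HSPPlus.ops K).IsMorphism (FQSymPlus.ops K) (thetaPlus K) where
  map_mul x y := by
    induction x using HSPPlus.induction_single with
    | zero => simp
    | add x x' hx hx' => simp only [map_add, LinearMap.add_apply, hx, hx']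
    | smul a x hx => simp only [map_smul, LinearMap.smul_apply, hx]
    | single P =>
    induction y using HSPPlus.induction_single with
    | zero => simp
    | add x x' hx hx' => simp only [map_add, hx, hx']
    | smul a x hx => simp only [map_smul, hx]
    | single Q => exact thetaPlus_mul_single P Q
  map_nw x y := by
    induction x using HSPPlus.induction_single with
    | zero => simp
    | add x x' hx hx' => simp only [map_add, LinearMap.add_apply, hx, hx']
    | smul a x hx => simp only [map_smul, LinearMap.smul_apply, hx]
    | single P =>
    induction y using HSPPlus.induction_single with
    | zero => simp
    | add x x' hx hx' => simp only [map_add, hx, hx']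
    | smul a x hx => simp only [map_smul, hx]
    | single Q => exact thetaPlus_nw_single P Q
  map_prec := LinearMap.congr_fun (f := TensorProduct.map (thetaPlus K) (thetaPlus K) ∘ₗ
    (HSPPlus.ops K).prec) (g := (FQSymPlus.ops K).prec ∘ₗ thetaPlus K)
    (HSPPlus.linearMap_ext thetaPlus_prec_single)
  map_succ := LinearMap.congr_fun (f := TensorProduct.map (thetaPlus K) (thetaPlus K) ∘ₗ
    (HSPPlus.ops K).succ) (g := (FQSymPlus.ops K).succ ∘ₗ thetaPlus K)
    (HSPPlus.linearMap_ext thetaPlus_succ_single)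

theorem mainTheorem10 (K : Type*) [Field K] :
    (FQSymPlus.ops K).IsBialgebra ∧
      (HSPPlus.ops K).IsBialgebra ∧
      (HSPPlus.ops K).IsMorphism (FQSymPlus.ops K) (thetaPlus K) :=
  ⟨(isMorphism_thetaPlus K).isBialgebra_of_surjective thetaPlus_surjective HSPPlus.isBialgebra,
    HSPPlus.isBialgebra, isMorphism_thetaPlus K⟩
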